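/- **Setting.** A principal and one agent interact for $T$ rounds. Efforts lie in $[0,E]$, $E>0$; the cost $c:[0,E]\to\mathbb R$ is nondecreasing, $c(0)=0$, and $\lambda$-strongly convex ($c(x)-\tfrac{\lambda}{2}x^2$ is convex), $\lambda>0$. An effort $a$ produces a random output $y\in[0,1]$ with mean $a$, drawn from a fixed technology $F(a)$ (a Markov kernel). In round $t$ the principal posts a linear contract $\beta_t\in[0,1]$, drawn according to a mechanism from a distribution that depends on $(\beta_s,y_s)_{s<t}$; the agent chooses $a_t$, drawn from a distribution that depends on $(\beta_s,a_s,y_s)_{s<t}$ and $\beta_t$; then $y_t\sim F(a_t)$ is observed. Knowing the mechanism $\mathcal M$, the agent uses a strategy that maximizes $\mathbb E\sum_{t=1}^T\gamma^t(\beta_ty_t-c(a_t))$, where $\gamma\in(0,1)$. For every $\beta\in[0,1]$ let $a(\beta)\in\arg\max_{x\in[0,E]}(\beta x-c(x))$ be the myopic best response (assumed to exist), and let $u(\beta)=(1-\beta)a(\beta)$. The strategic regret is $$\mathrm{Reg}(\mathcal M)=\max_{\beta\in[0,1]}T\,u(\beta)-\mathbb E\Big[\sum_{t=1}^T(1-\beta_t)y_t\Big].$$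 Put $T_\gamma=\sum_{t=1}^T\gamma^t$. **Delayed elimination** with contracts $\mathcal C$, delay $D$ and perturbation $\delta\ge 0$ keeps an active set $A$, initially $A=\mathcal C$, and runs in stages until $T$ rounds have been played. In a stage that starts after $t$ rounds, each $\beta\in A$ is posted once. At its end let $S_\beta=\{1\le\tau<t-D:\beta_\tau=\beta\}$, $\hat u(\beta)=|S_\beta|^{-1}\sum_{\tau\in S_\beta}(1-\beta)y_\tau$, and $$\mathrm{UCB}(\beta),\ \mathrm{LCB}(\beta)=\hat u(\beta)\pm\Big(\sqrt{2\log T/|S_\beta|}+\delta\Big)$$ ($\pm\infty$ if $S_\beta=\emptyset$); every $\beta\in A$ with $\mathrm{UCB}(\beta)<\max_{\beta'\in A}\mathrm{LCB}(\beta')$ is removed from $A$. **Theorem.** There are choices of an integer $K\ge1$, an integer $D\ge0$ and a real $\delta\ge0$, as functions of $(T,\gamma,\lambda)$ only, such that delayed elimination on the discretized contract space $\{\tfrac1K,\tfrac2K,\dots,\tfrac KK\}$ has the following property. Let $E,c$ be such that $u$ has a unique maximizer $\beta^*$ on $[0,1]$, $u$ is differentiable near $\beta^*$ and twice differentiable at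 $\beta^*$, and $u''(\beta^*)\ne0$. Then there are constants $B,T_0$, depending only on $E$ and $c$, such that for every $\lambda>0$ for which $c$ is $\lambda$-strongly convex, every $\gamma\in(0,1)$, every $T\ge T_0$, every technology $F$ and every optimal strategy of the agent, $$\mathrm{Reg}\le B\left(\sqrt{T\log T}+\frac{\log(T\,T_\gamma/\lambda)\,\log(T/\log T)}{\log(1/\gamma)}\right).$$ -/

import Mathlib

open MeasureTheory ProbabilityTheory Set Filter Topology

noncomputable section

namespace RepeatedContract

/-! ### The repeated interaction

Rounds are indexed from `0`: index `i` stands for round `i + 1`.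
A linear contract is a share `β ∈ [0,1]`, an effort is a point of `[0,E]`, an output is a point
of `[0,1]`. -/

/-- Effort levels `[0,E]`. -/
abbrev Effort (E : ℝ) : Type := Set.Icc (0 : ℝ) E

/-- What the principal has seen after `t` rounds: the pairs (contract, output). -/
abbrev PublicHistory (t : ℕ) : Type := Fin t → unitInterval × unitInterval

/-- What the agent has seen after `t` rounds: the triples (contract, effort, output). -/
abbrev History (E : ℝ) (t : ℕ) : Type := Fin t → unitInterval × Effort E × unitInterval

/-- The part of the history that the principal observes. -/
def publicPart {E : ℝ} {t : ℕ} (h : History E t) : PublicHistory t :=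
  fun i => ((h i).1, (h i).2.2)

theorem measurable_publicPart {E : ℝ} {t : ℕ} :
    Measurable (publicPart : History E t → PublicHistory t) := by
  unfold publicPart
  fun_prop

/-- A (possibly randomized) mechanism of the principal: in each round, a distribution over
contracts that depends on the contracts and outputs of the previous rounds. -/
structure Mechanism where
  post : ∀ t : ℕ, Kernel (PublicHistory t) unitInterval
  isMarkov : ∀ t : ℕ, IsMarkovKernel (post t)

attribute [instance] Mechanism.isMarkov

/-- A (possibly randomized) strategy of the agent: in each round, a distribution over efforts that
depends on the contracts, efforts and outputs of the previous rounds and on the contract posted in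
the current round. -/
structure Strategy (E : ℝ) where
  act : ∀ t : ℕ, Kernel (History E t × unitInterval) (Effort E)
  isMarkov : ∀ t : ℕ, IsMarkovKernel (act t)

attribute [instance] Strategy.isMarkov

/-- A production technology: effort `a` gives a random output in `[0,1]` with mean `a`
(a random variable in `[0,1]` is subgaussian). -/
structure Technology (E : ℝ) where
  output : Kernel (Effort E) unitInterval
  isMarkov : IsMarkovKernel output
  mean_output : ∀ a : Effort E, ∫ y, (y : ℝ) ∂(output a) = (a : ℝ)

attribute [instance] Technology.isMarkov

/-- One round after the history `h`: the mechanism posts `β`, the agent picks the effort `a`, the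
technology produces the output `y`; the law of `(β, a, y)`. -/
def roundKernel {E : ℝ} (M : Mechanism) (S : Strategy E) (F : Technology E) (t : ℕ) :
    Kernel (History E t) (unitInterval × Effort E × unitInterval) :=
  ((M.post t).comap publicPart measurable_publicPart) ⊗ₖ
    (S.act t ⊗ₖ Kernel.prodMkLeft (History E t × unitInterval) F.output)

/-- The law of the history of the first `t` rounds. -/
def law {E : ℝ} (M : Mechanism) (S : Strategy E) (F : Technology E) :
    (t : ℕ) → Measure (History E t)
  | 0 => Measure.dirac (fun i => i.elim0)
  | t + 1 => (law M S F t ⊗ₘ roundKernel M S F t).map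
      (fun p => Fin.snoc (α := fun _ => unitInterval × Effort E × unitInterval) p.1 p.2)

/-- The agent's expected discounted utility `𝔼 ∑_{t=1}^T γ^t (β_t y_t - c(a_t))`. -/
def agentValue {E : ℝ} (c : ℝ → ℝ) (γ : ℝ) (T : ℕ) (F : Technology E) (M : Mechanism)
    (S : Strategy E) : ℝ :=
  ∫ h, ∑ i : Fin T, γ ^ ((i : ℕ) + 1) *
    (((h i).1 : ℝ) * ((h i).2.2 : ℝ) - c ((h i).2.1 : ℝ)) ∂(law M S F T)

/-- The strategy `S` maximizes the agent's expected discounted utility against `M`. -/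
def IsOptimalStrategy {E : ℝ} (c : ℝ → ℝ) (γ : ℝ) (T : ℕ) (F : Technology E) (M : Mechanism)
    (S : Strategy E) : Prop :=
  ∀ S' : Strategy E, agentValue c γ T F M S' ≤ agentValue c γ T F M S

/-- The principal's expected total utility `𝔼 ∑_{t=1}^T (1 - β_t) y_t`. -/
def principalValue {E : ℝ} (T : ℕ) (F : Technology E) (M : Mechanism) (S : Strategy E) : ℝ :=
  ∫ h, ∑ i : Fin T, (1 - ((h i).1 : ℝ)) * ((h i).2.2 : ℝ) ∂(law M S F T)

/-- `a β` is a myopic best response to the contract `β`, for every `β ∈ [0,1]`. -/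
def IsBestResponse (E : ℝ) (c a : ℝ → ℝ) : Prop :=
  ∀ β ∈ Set.Icc (0 : ℝ) 1, a β ∈ Set.Icc (0 : ℝ) E ∧
    ∀ x ∈ Set.Icc (0 : ℝ) E, β * x - c x ≤ β * a β - c (a β)

/-- The principal's expected one-round utility `u(β) = (1 - β) a(β)` under truthful response. -/
def truthfulUtility (a : ℝ → ℝ) (β : ℝ) : ℝ := (1 - β) * a β

/-- The strategic regret `max_{β ∈ [0,1]} T u(β) - 𝔼 ∑_{t=1}^T (1 - β_t) y_t`. -/
def strategicRegret {E : ℝ} (a : ℝ → ℝ) (T : ℕ) (F : Technology E) (M : Mechanism)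
    (S : Strategy E) : ℝ :=
  (⨆ β : Set.Icc (0 : ℝ) 1, (T : ℝ) * truthfulUtility a β) - principalValue T F M S

/-- `T_γ = ∑_{t=1}^T γ^t`. -/
def discountSum (γ : ℝ) (T : ℕ) : ℝ := ∑ t ∈ Finset.Icc 1 T, γ ^ t

/-! ### Delayed elimination

The algorithm runs in stages. At the start of a stage `t` rounds have been played; in the stage
each active contract is posted once. At its end the confidence bounds are computed from the rounds
`τ < t - D` only, and the contracts whose upper bound is below the lower bound of another active
contract are removed. -/

section Elimination

variable {K n : ℕ}

/-- The rounds `1 ≤ τ < t - D` in which the contract `β` was posted. -/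
def samples (D t : ℕ) (h : PublicHistory n) (β : unitInterval) : Finset (Fin n) :=
  Finset.univ.filter (fun τ => (τ : ℕ) + 1 + D < t ∧ (h τ).1 = β)

/-- Average utility of the principal over these rounds. -/
def meanUtility (D t : ℕ) (h : PublicHistory n) (β : unitInterval) : ℝ :=
  (∑ τ ∈ samples D t h β, (1 - (β : ℝ)) * ((h τ).2 : ℝ)) / ((samples D t h β).card : ℝ)

/-- Half-width of the adjusted confidence interval. -/
def radius (T D : ℕ) (δ : ℝ) (t : ℕ) (h : PublicHistory n) (β : unitInterval) : ℝ :=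
  Real.sqrt (2 * Real.log (T : ℝ) / ((samples D t h β).card : ℝ)) + δ

/-- `UCB(β) < LCB(β')`. With no sample the bounds are `+∞` and `-∞`, so the inequality fails. -/
def Beats (T D : ℕ) (δ : ℝ) (t : ℕ) (h : PublicHistory n) (β' β : unitInterval) : Prop :=
  (samples D t h β).Nonempty ∧ (samples D t h β').Nonempty ∧
    meanUtility D t h β + radius T D δ t h β < meanUtility D t h β' - radius T D δ t h β'

open Classical in
/-- The active contracts that survive the elimination at the end of a stage started at `t`. -/
def survivors (C : Fin K → unitInterval) (T D : ℕ) (δ : ℝ) (t : ℕ) (h : PublicHistory n)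
    (A : Finset (Fin K)) : Finset (Fin K) :=
  A.filter (fun k => ¬ ∃ k' ∈ A, Beats T D δ t h (C k') (C k))

/-- For the round that follows `m` played rounds: the active set of its stage, and the number of
rounds played before that stage. -/
def stage (C : Fin K → unitInterval) (T D : ℕ) (δ : ℝ) (h : PublicHistory n) :
    ℕ → Finset (Fin K) × ℕ
  | 0 => (Finset.univ, 0)
  | m + 1 =>
    if m + 1 < (stage C T D δ h m).2 + (stage C T D δ h m).1.card then stage C T D δ h m
    else (survivors C T D δ (stage C T D δ h m).2 h (stage C T D δ h m).1, m + 1)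

/-- The contract posted by a stage in the round that follows `m` played rounds: the active
contracts are posted one after another, in the order of their indices. -/
def posted (C : Fin K → unitInterval) (m : ℕ) (s : Finset (Fin K) × ℕ) : unitInterval :=
  ((s.1.sort (· ≤ ·)).map C).getD (m - s.2) 0

theorem measurableSet_and {α : Type*} [MeasurableSpace α] {p q : α → Prop}
    (hp : MeasurableSet {x | p x}) (hq : MeasurableSet {x | q x}) :
    MeasurableSet {x | p x ∧ q x} := hp.inter hq

theorem measurableSet_prop {α : Type*} [MeasurableSpace α] (p : Prop) :
    MeasurableSet {_x : α | p} := MeasurableSet.const p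

theorem measurableSet_iff {α : Type*} [MeasurableSpace α] {p q : α → Prop}
    (hp : MeasurableSet {x | p x}) (hq : MeasurableSet {x | q x}) :
    MeasurableSet {x | p x ↔ q x} :=
  measurableSet_setOfPred.2 ((measurableSet_setOfPred.1 hp).iff (measurableSet_setOfPred.1 hq))

theorem measurableSet_samples_eq (D t : ℕ) (β : unitInterval) (s : Finset (Fin n)) :
    MeasurableSet {h : PublicHistory n | samples D t h β = s} := by
  have : {h : PublicHistory n | samples D t h β = s} =
      ⋂ τ : Fin n, {h | ((τ : ℕ) + 1 + D < t ∧ (h τ).1 = β) ↔ τ ∈ s} := by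
    ext h
    simp [samples, Finset.ext_iff]
  rw [this]
  refine MeasurableSet.iInter fun τ => ?_
  have h1 : MeasurableSet {h : PublicHistory n | (h τ).1 = β} :=
    (measurable_fst.comp (measurable_pi_apply τ)) (measurableSet_singleton β)
  exact measurableSet_iff (measurableSet_and (measurableSet_prop _) h1) (measurableSet_prop _)

theorem measurableSet_beats (T D : ℕ) (δ : ℝ) (t : ℕ) (β' β : unitInterval) :
    MeasurableSet {h : PublicHistory n | Beats T D δ t h β' β} := by
  have : {h : PublicHistory n | Beats T D δ t h β' β} =
      ⋃ s : Finset (Fin n), ⋃ s' : Finset (Fin n),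
        ({h | samples D t h β = s} ∩ {h | samples D t h β' = s'}) ∩
        {h | s.Nonempty ∧ s'.Nonempty ∧
          (∑ τ ∈ s, (1 - (β : ℝ)) * ((h τ).2 : ℝ)) / (s.card : ℝ) +
            (Real.sqrt (2 * Real.log (T : ℝ) / (s.card : ℝ)) + δ) <
          (∑ τ ∈ s', (1 - (β' : ℝ)) * ((h τ).2 : ℝ)) / (s'.card : ℝ) -
            (Real.sqrt (2 * Real.log (T : ℝ) / (s'.card : ℝ)) + δ)} := by
    ext h
    simp [Beats, meanUtility, radius]
  rw [this]
  refine MeasurableSet.iUnion fun s => MeasurableSet.iUnion fun s' => ?_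
  refine ((measurableSet_samples_eq D t β s).inter (measurableSet_samples_eq D t β' s')).inter ?_
  refine measurableSet_and (measurableSet_prop _) (measurableSet_and (measurableSet_prop _) ?_)
  exact measurableSet_lt (by fun_prop) (by fun_prop)

theorem measurableSet_survivors_eq (C : Fin K → unitInterval) (T D : ℕ) (δ : ℝ) (t : ℕ)
    (A B : Finset (Fin K)) :
    MeasurableSet {h : PublicHistory n | survivors C T D δ t h A = B} := by
  have : {h : PublicHistory n | survivors C T D δ t h A = B} =
      ⋂ k : Fin K, {h | (k ∈ A ∧ ¬ ∃ k', k' ∈ A ∧ Beats T D δ t h (C k') (C k)) ↔ k ∈ B} := by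
    ext h
    simp [survivors, Finset.ext_iff]
  rw [this]
  refine MeasurableSet.iInter fun k => ?_
  refine measurableSet_iff (measurableSet_and (measurableSet_prop _) ?_) (measurableSet_prop _)
  refine MeasurableSet.compl (s := {h | ∃ k', k' ∈ A ∧ Beats T D δ t h (C k') (C k)}) ?_
  refine measurableSet_setOfPred.2 (Measurable.exists fun k' => measurableSet_setOfPred.1 ?_)
  exact measurableSet_and (measurableSet_prop _) (measurableSet_beats T D δ t (C k') (C k))

theorem measurableSet_stage_eq (C : Fin K → unitInterval) (T D : ℕ) (δ : ℝ) (m : ℕ)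
    (s : Finset (Fin K) × ℕ) :
    MeasurableSet {h : PublicHistory n | stage C T D δ h m = s} := by
  induction m generalizing s with
  | zero => exact measurableSet_prop ((Finset.univ, 0) = s)
  | succ m ih =>
    have : {h : PublicHistory n | stage C T D δ h (m + 1) = s} =
        ⋃ r : Finset (Fin K) × ℕ, {h | stage C T D δ h m = r} ∩
          {h | (if m + 1 < r.2 + r.1.card then r
            else (survivors C T D δ r.2 h r.1, m + 1)) = s} := by
      ext h
      simp only [mem_ofPred_eq, mem_iUnion, mem_inter_iff, exists_eq_left', stage]
    rw [this]
    refine MeasurableSet.iUnion fun r => (ih r).inter ?_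
    by_cases hr : m + 1 < r.2 + r.1.card
    · simp only [hr, if_true]
      exact measurableSet_prop _
    · simp only [hr, if_false, Prod.ext_iff]
      exact measurableSet_and (measurableSet_survivors_eq C T D δ r.2 r.1 s.1)
        (measurableSet_prop _)

theorem measurable_posted_stage (C : Fin K → unitInterval) (T D : ℕ) (δ : ℝ) :
    Measurable (fun h : PublicHistory n => posted C n (stage C T D δ h n)) := by
  intro U _
  have : (fun h : PublicHistory n => posted C n (stage C T D δ h n)) ⁻¹' U =
      ⋃ s : Finset (Fin K) × ℕ, {h | stage C T D δ h n = s} ∩ {_h | posted C n s ∈ U} := by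
    ext h
    simp
  rw [this]
  exact MeasurableSet.iUnion fun s =>
    (measurableSet_stage_eq C T D δ n s).inter (measurableSet_prop _)

end Elimination

/-- Delayed elimination over the contracts `C 0, …, C (K-1)`, with horizon `T`, delay `D` and
perturbation `δ`. -/
def delayedElimination {K : ℕ} (C : Fin K → unitInterval) (T D : ℕ) (δ : ℝ) : Mechanism where
  post n := Kernel.deterministic (fun h : PublicHistory n => posted C n (stage C T D δ h n))
    (measurable_posted_stage C T D δ)
  isMarkov _ := inferInstance

/-- The discretized contract space `1/K, 2/K, …, K/K`. -/
def grid (K : ℕ) (k : Fin K) : unitInterval :=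
  Set.projIcc (0 : ℝ) 1 zero_le_one (((k : ℕ) + 1 : ℝ) / (K : ℝ))

end RepeatedContract

end

/-! The delay makes an optimal agent almost myopic, and elimination with confidence intervals then
works as in a stochastic bandit problem.

Incentives. The active sets of the rounds up to `t + D + 1` are functions of the first `t` rounds
(`stage_castLE`). If the agent switches to myopic play from round `i` on, the law of the contracts
in the next `D + 1` rounds is unchanged, so nothing is lost there; each later round loses at most
one unit, discounted by at least `γ ^ D` relative to round `i`. Optimality bounds the expected
myopic loss of every round by `T * γ ^ D` (`expected_loss_le`). Strong convexity turns this loss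
into a squared effort error (`quadratic_le_loss`). With `D` about `log (T ^ 6 / lam) / log (1 / γ)`
the mean square error is at most `4 / T ^ 5`, so by Markov's inequality and a union bound all
efforts are within `δ = 1 / T` of the myopic ones, up to a probability of order `T ^ (-2)`.

Concentration. Outputs centred at the realized effort are martingale differences, and Hoeffding's
lemma gives an exponential supermartingale (`lintegral_exp_centered_le_one`). A union bound over
times, contracts, sample sizes and signs yields valid confidence intervals (`accurate_of_notMem`).

Elimination on an accurate path (`sum_gap_le`). The best contract survives, and active contracts are
posted in turn. Sort the contracts by the dyadic scale `2 ^ (-l)` of their gap; scale `l` is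
detectable after about `4 ^ l * log T` plays. The early plays cost about `log T / gap` per contract.
The late plays of one whole scale lie in a window of `D + 1 + 2 * K` rounds, since one contract with
enough plays means that all active ones have enough. Summing over the scales is a geometric series,
so the delay is paid only a constant number of times.

Geometry. Near a nondegenerate maximizer the gap is comparable to the squared distance, and
compactness extends this to `[0,1]` (`exists_quadratic_gap`). On the grid the sum of the inverse
gaps is therefore `O(K ^ 2)`, and the regret is of order `T / K ^ 2 + K ^ 2 * log T + D + K`. The
choice `K ^ 4 ≈ T / log T` balances the first two terms. -/

namespace RepeatedContract

open scoped ENNReal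

/-! ### Deterministic bookkeeping: play counts and stages along a path -/

section Path

variable {K n : ℕ}

/-- Number of times the contract `β` is posted in the first `m` rounds. -/
noncomputable def plays (h : PublicHistory n) (β : unitInterval) (m : ℕ) : ℕ :=
  (Finset.univ.filter (fun τ : Fin n => (τ : ℕ) < m ∧ (h τ).1 = β)).card

/-- Rounds are indexed from zero, so `τ + 1 + D < t` is `τ < t - 1 - D`, also when the subtraction
truncates. -/
theorem samples_card (D t : ℕ) (h : PublicHistory n) (β : unitInterval) :
    (samples D t h β).card = plays h β (t - 1 - D) := by
  unfold samples plays
  congr 1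
  ext τ
  simp only [Finset.mem_filter, Finset.mem_univ, true_and]
  constructor <;> rintro ⟨h1, h2⟩ <;> exact ⟨by omega, h2⟩

theorem plays_zero (h : PublicHistory n) (β : unitInterval) : plays h β 0 = 0 := by
  simp [plays]

theorem plays_mono (h : PublicHistory n) (β : unitInterval) : Monotone (plays h β) := by
  intro m m' hm
  refine Finset.card_le_card fun τ => ?_
  simp only [Finset.mem_filter, Finset.mem_univ, true_and]
  rintro ⟨h1, h2⟩
  exact ⟨by omega, h2⟩

theorem plays_succ (h : PublicHistory n) (β : unitInterval) (m : Fin n) :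
    plays h β (m + 1) = plays h β m + if (h m).1 = β then 1 else 0 := by
  unfold plays
  split_ifs with hm
  · rw [← Finset.card_insert_of_notMem (a := m) (by simp)]
    congr 1
    ext τ
    simp only [Finset.mem_filter, Finset.mem_univ, true_and, Finset.mem_insert]
    constructor
    · rintro ⟨h1, h2⟩
      by_cases he : τ = m
      · exact Or.inl he
      · exact Or.inr ⟨lt_of_le_of_ne (by omega) (fun h' => he (Fin.ext h')), h2⟩
    · rintro (rfl | ⟨h1, h2⟩)
      · exact ⟨by omega, hm⟩
      · exact ⟨by omega, h2⟩
  · rw [add_zero]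
    congr 1
    ext τ
    simp only [Finset.mem_filter, Finset.mem_univ, true_and]
    constructor
    · rintro ⟨h1, h2⟩
      refine ⟨lt_of_le_of_ne (by omega) (fun h' => hm ?_), h2⟩
      rwa [← Fin.ext h']
    · rintro ⟨h1, h2⟩
      exact ⟨by omega, h2⟩

/-- A contract is posted at most `q` times while it has been posted fewer than `q` times. -/
theorem card_early_le (h : PublicHistory n) (β : unitInterval) (q : ℕ) :
    (Finset.univ.filter (fun τ : Fin n => (h τ).1 = β ∧ plays h β τ < q)).card ≤ q := by
  -- The bound by the play count has to be carried along: a new round enters the set only while that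
  -- count is below `q`.
  have key : ∀ m ≤ n, (Finset.univ.filter
      (fun τ : Fin n => (τ : ℕ) < m ∧ (h τ).1 = β ∧ plays h β τ < q)).card ≤
        min q (plays h β m) := by
    intro m hm
    induction m with
    | zero => simp
    | succ m ih =>
      have ih := ih (by omega)
      have hs := plays_succ h β ⟨m, hm⟩
      simp only at hs
      by_cases hc : (h ⟨m, hm⟩).1 = β ∧ plays h β m < q
      · rw [if_pos hc.1] at hs
        have : (Finset.univ.filter
            (fun τ : Fin n => (τ : ℕ) < m + 1 ∧ (h τ).1 = β ∧ plays h β τ < q)) ⊆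
            insert ⟨m, hm⟩ (Finset.univ.filter
            (fun τ : Fin n => (τ : ℕ) < m ∧ (h τ).1 = β ∧ plays h β τ < q)) := by
          intro τ
          simp only [Finset.mem_filter, Finset.mem_univ, true_and, Finset.mem_insert]
          rintro ⟨h1, h2⟩
          by_cases he : (τ : ℕ) = m
          · exact Or.inl (Fin.ext he)
          · exact Or.inr ⟨by omega, h2⟩
        have h3 := (Finset.card_le_card this).trans (Finset.card_insert_le _ _)
        have h4 := hc.2
        omega
      · have : (Finset.univ.filter
            (fun τ : Fin n => (τ : ℕ) < m + 1 ∧ (h τ).1 = β ∧ plays h β τ < q)) ⊆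
            (Finset.univ.filter
            (fun τ : Fin n => (τ : ℕ) < m ∧ (h τ).1 = β ∧ plays h β τ < q)) := by
          intro τ
          simp only [Finset.mem_filter, Finset.mem_univ, true_and]
          rintro ⟨h1, h2⟩
          refine ⟨lt_of_le_of_ne (by omega) (fun he => hc ?_), h2⟩
          have : τ = ⟨m, hm⟩ := Fin.ext he
          subst this
          exact h2
        have h3 := Finset.card_le_card this
        omega
  refine (Finset.card_le_card fun τ => ?_).trans ((key n le_rfl).trans (min_le_left _ _))
  simp only [Finset.mem_filter, Finset.mem_univ, true_and]
  exact fun h' => ⟨τ.2, h'⟩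

variable (C : Fin K → unitInterval) (T D : ℕ) (δ : ℝ) (h : PublicHistory n)

theorem stage_succ_of_lt {m : ℕ}
    (hm : m + 1 < (stage C T D δ h m).2 + (stage C T D δ h m).1.card) :
    stage C T D δ h (m + 1) = stage C T D δ h m := by
  rw [stage, if_pos hm]

theorem stage_succ_of_not_lt {m : ℕ}
    (hm : ¬ m + 1 < (stage C T D δ h m).2 + (stage C T D δ h m).1.card) :
    stage C T D δ h (m + 1) =
      (survivors C T D δ (stage C T D δ h m).2 h (stage C T D δ h m).1, m + 1) := by
  rw [stage, if_neg hm]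

theorem survivors_subset (t : ℕ) (A : Finset (Fin K)) :
    survivors C T D δ t h A ⊆ A := by
  classical exact Finset.filter_subset _ _

theorem stage_start_le (m : ℕ) : (stage C T D δ h m).2 ≤ m := by
  induction m with
  | zero => simp [stage]
  | succ m ih =>
    by_cases hm : m + 1 < (stage C T D δ h m).2 + (stage C T D δ h m).1.card
    · rw [stage_succ_of_lt C T D δ h hm]; omega
    · rw [stage_succ_of_not_lt C T D δ h hm]

theorem active_antitone : Antitone (fun m => (stage C T D δ h m).1) := by
  refine antitone_nat_of_succ_le fun m => ?_
  by_cases hm : m + 1 < (stage C T D δ h m).2 + (stage C T D δ h m).1.card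
  · rw [stage_succ_of_lt C T D δ h hm]
  · rw [stage_succ_of_not_lt C T D δ h hm]
    exact survivors_subset C T D δ h _ _

variable {C T D δ h}

/-- As long as something is active, the next round lies inside the current stage, so the default
value in `posted` is never reached. -/
theorem lt_stage_end (hA : ∀ m, (stage C T D δ h m).1.Nonempty) (m : ℕ) :
    m < (stage C T D δ h m).2 + (stage C T D δ h m).1.card := by
  induction m with
  | zero =>
    have := (hA 0).card_pos
    omega
  | succ m ih =>
    by_cases hm : m + 1 < (stage C T D δ h m).2 + (stage C T D δ h m).1.card
    · rw [stage_succ_of_lt C T D δ h hm]; omega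
    · have := (hA (m + 1)).card_pos
      rw [stage_succ_of_not_lt C T D δ h hm] at this ⊢
      simp only at this ⊢
      omega

/-- Position of `k` in the order in which the active contracts `A` are posted. -/
def position (A : Finset (Fin K)) (k : Fin K) : ℕ := (A.sort (· ≤ ·)).idxOf k

theorem position_lt {A : Finset (Fin K)} {k : Fin K} (hk : k ∈ A) : position A k < A.card := by
  rw [← Finset.length_sort (s := A) (· ≤ ·)]
  exact List.idxOf_lt_length_iff.2 ((Finset.mem_sort _).2 hk)

theorem posted_eq_iff (hC : Function.Injective C) {m : ℕ} {s : Finset (Fin K) × ℕ}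
    (hm : m - s.2 < s.1.card) {k : Fin K} (hk : k ∈ s.1) :
    posted C m s = C k ↔ position s.1 k = m - s.2 := by
  have hl : m - s.2 < (s.1.sort (· ≤ ·)).length := by rwa [Finset.length_sort]
  have hkl : (s.1.sort (· ≤ ·)).idxOf k < (s.1.sort (· ≤ ·)).length :=
    List.idxOf_lt_length_iff.2 ((Finset.mem_sort _).2 hk)
  unfold posted position
  rw [List.getD_eq_getElem _ _ (by simpa using hl), List.getElem_map, hC.eq_iff]
  constructor
  · rintro rfl
    exact (Finset.sort_nodup _ _).idxOf_getElem _ hl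
  · intro he
    simp only [← he]
    exact List.getElem_idxOf hkl

theorem exists_posted_eq {m : ℕ} {s : Finset (Fin K) × ℕ} (hm : m - s.2 < s.1.card) :
    ∃ k ∈ s.1, posted C m s = C k := by
  have hl : m - s.2 < (s.1.sort (· ≤ ·)).length := by rwa [Finset.length_sort]
  refine ⟨(s.1.sort (· ≤ ·))[m - s.2], (Finset.mem_sort (· ≤ ·)).1 (List.getElem_mem hl), ?_⟩
  unfold posted
  rw [List.getD_eq_getElem _ _ (by simpa using hl), List.getElem_map]

/-- Along a path of the mechanism, an active contract has been posted once in each completed stage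
and at most once in the current one. -/
theorem plays_eq (hC : Function.Injective C) (hA : ∀ m, (stage C T D δ h m).1.Nonempty)
    (hp : ∀ i : Fin n, (h i).1 = posted C i (stage C T D δ h i)) (m : ℕ) (hm : m ≤ n) :
    ∃ j, ∀ k ∈ (stage C T D δ h m).1, plays h (C k) m =
      j + if position (stage C T D δ h m).1 k < m - (stage C T D δ h m).2 then 1 else 0 := by
  induction m with
  | zero => exact ⟨0, fun k _ => by simp [plays_zero]⟩
  | succ m ih =>
    obtain ⟨j, hj⟩ := ih (by omega)
    have hlt := lt_stage_end hA m
    have hle := stage_start_le C T D δ h m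
    have hstep : ∀ k ∈ (stage C T D δ h m).1, plays h (C k) (m + 1) =
        j + if position (stage C T D δ h m).1 k < m + 1 - (stage C T D δ h m).2
          then 1 else 0 := by
      intro k hk
      have h1 := plays_succ h (C k) ⟨m, hm⟩
      simp only at h1
      rw [h1, hj k hk, hp ⟨m, hm⟩]
      simp only [posted_eq_iff hC (show m - (stage C T D δ h m).2 < _ by omega) hk]
      split_ifs <;> omega
    by_cases hmm : m + 1 < (stage C T D δ h m).2 + (stage C T D δ h m).1.card
    · rw [stage_succ_of_lt C T D δ h hmm]
      exact ⟨j, hstep⟩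
    -- The stage is complete: every position is below the number of active contracts, so all
    -- survivors have had their turn and the common count goes up.
    · refine ⟨j + 1, fun k hk => ?_⟩
      have hk' : k ∈ (stage C T D δ h m).1 := active_antitone C T D δ h (Nat.le_succ m) hk
      have := position_lt hk'
      rw [hstep k hk', if_pos (by omega), stage_succ_of_not_lt C T D δ h hmm]
      simp

/-- The contract posted in a round is an active one with the fewest plays. -/
theorem posted_min_plays (hC : Function.Injective C)
    (hA : ∀ m, (stage C T D δ h m).1.Nonempty)
    (hp : ∀ i : Fin n, (h i).1 = posted C i (stage C T D δ h i)) (i : Fin n) :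
    ∃ k ∈ (stage C T D δ h i).1, (h i).1 = C k ∧
      ∀ k' ∈ (stage C T D δ h i).1, plays h (C k) i ≤ plays h (C k') i := by
  have hlt := lt_stage_end hA i
  have hle := stage_start_le C T D δ h i
  have hlt' : (i : ℕ) - (stage C T D δ h i).2 < (stage C T D δ h i).1.card := by omega
  obtain ⟨k, hk, hki⟩ := exists_posted_eq (C := C) hlt'
  obtain ⟨j, hj⟩ := plays_eq hC hA hp i i.2.le
  refine ⟨k, hk, (hp i).trans hki, fun k' hk' => ?_⟩
  -- The posted contract sits exactly at the current position, so its own turn in this stage is not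
  -- yet counted.
  rw [hj k hk, hj k' hk', if_neg]
  · omega
  · rw [(posted_eq_iff hC hlt' hk).1 hki]
    omega

end Path

/-! ### Elimination along a path with correct confidence intervals -/

section Accurate

variable {K n : ℕ}

/-- All confidence intervals along the path `h` contain the true utilities `u`. -/
def Accurate (C : Fin K → unitInterval) (T D : ℕ) (δ : ℝ) (u : Fin K → ℝ)
    (h : PublicHistory n) : Prop :=
  ∀ t k, (samples D t h (C k)).Nonempty →
    |meanUtility D t h (C k) - u k| ≤ radius T D δ t h (C k)

variable {C : Fin K → unitInterval} {T D : ℕ} {δ : ℝ} {h : PublicHistory n} {u : Fin K → ℝ}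
  {ks : Fin K}

/-- If `k` beat `ks`, then `u ks ≤ UCB(ks) < LCB(k) ≤ u k`, against maximality. -/
theorem best_active (hacc : Accurate C T D δ u h) (hks : ∀ k, u k ≤ u ks) (m : ℕ) :
    ks ∈ (stage C T D δ h m).1 := by
  induction m with
  | zero => simp [stage]
  | succ m ih =>
    by_cases hm : m + 1 < (stage C T D δ h m).2 + (stage C T D δ h m).1.card
    · rwa [stage_succ_of_lt C T D δ h hm]
    · rw [stage_succ_of_not_lt C T D δ h hm]
      unfold survivors
      simp only [Finset.mem_filter]
      refine ⟨ih, ?_⟩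
      rintro ⟨k, -, h1, h2, h3⟩
      have e1 := abs_le.1 (hacc _ _ h1)
      have e2 := abs_le.1 (hacc _ _ h2)
      have := hks k
      linarith [e1.1, e2.2]

theorem radius_le (hT : 1 ≤ T) {t q : ℕ} {β : unitInterval} (hq : 0 < q)
    (h' : q ≤ (samples D t h β).card) :
    radius T D δ t h β ≤ Real.sqrt (2 * Real.log T / q) + δ := by
  unfold radius
  have : 0 ≤ Real.log (T : ℝ) := Real.log_nonneg (by exact_mod_cast hT)
  have : (0 : ℝ) < q := by exact_mod_cast hq
  have : (q : ℝ) ≤ (samples D t h β).card := by exact_mod_cast h'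
  gcongr

/-- Once every active contract has been posted `q` times, the contracts whose gap exceeds four
confidence radii are removed within `D + 1 + K` rounds. -/
theorem gap_le_of_active (hT : 1 ≤ T) (hacc : Accurate C T D δ u h) (hks : ∀ k, u k ≤ u ks)
    {m q : ℕ} (hq : 0 < q)
    (hm : ∀ k ∈ (stage C T D δ h m).1, q ≤ plays h (C k) m) (m' : ℕ)
    (hm' : m + D + 1 + K ≤ (stage C T D δ h m').2) :
    ∀ k ∈ (stage C T D δ h m').1,
      u ks - u k ≤ 4 * (Real.sqrt (2 * Real.log T / q) + δ) := by
  induction m' with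
  | zero => simp [stage] at hm'
  | succ m' ih =>
    by_cases hmm : m' + 1 < (stage C T D δ h m').2 + (stage C T D δ h m').1.card
    · rw [stage_succ_of_lt C T D δ h hmm] at hm' ⊢
      exact ih hm'
    · rw [stage_succ_of_not_lt C T D δ h hmm] at hm' ⊢
      intro k hk
      have hle := stage_start_le C T D δ h m'
      have hcard : (stage C T D δ h m').1.card ≤ K := by
        simpa using Finset.card_le_univ (stage C T D δ h m').1
      have hend := lt_stage_end (fun m => ⟨ks, best_active hacc hks m⟩) m'
      simp only at hm'
      -- A stage has at most `K` rounds, so the one that just ended started late enough for its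
      -- delayed samples to contain all of the first `m` rounds.
      have hstart : m + D + 1 ≤ (stage C T D δ h m').2 := by omega
      have hlarge : ∀ k ∈ (stage C T D δ h m').1,
          q ≤ (samples D (stage C T D δ h m').2 h (C k)).card := by
        intro k hk
        rw [samples_card]
        exact (hm k (active_antitone C T D δ h (by omega) hk)).trans (plays_mono _ _ (by omega))
      unfold survivors at hk
      simp only [Finset.mem_filter] at hk
      obtain ⟨hk1, hk2⟩ := hk
      have hks1 := best_active hacc hks m'
      have hn1 := Finset.card_pos.1 (hq.trans_le (hlarge k hk1))
      have hn2 := Finset.card_pos.1 (hq.trans_le (hlarge ks hks1))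
      have e1 := abs_le.1 (hacc _ _ hn1)
      have e2 := abs_le.1 (hacc _ _ hn2)
      have r1 := radius_le (δ := δ) hT hq (hlarge k hk1)
      have r2 := radius_le (δ := δ) hT hq (hlarge ks hks1)
      by_contra hcon
      push Not at hcon
      exact hk2 ⟨ks, hks1, hn1, hn2, by linarith [e1.2, e2.1]⟩

theorem card_le_of_diam_lt (s : Finset (Fin n)) (W : ℕ)
    (hs : ∀ i ∈ s, ∀ j ∈ s, (j : ℕ) < i + W) : s.card ≤ W := by
  rcases s.eq_empty_or_nonempty with rfl | hne
  · simp
  · have hmin := s.min'_mem hne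
    have hsub : s.image (fun i : Fin n => (i : ℕ)) ⊆
        Finset.Ico ((s.min' hne : Fin n) : ℕ) ((s.min' hne : Fin n) + W) := by
      intro j hj
      obtain ⟨i, hi, rfl⟩ := Finset.mem_image.1 hj
      exact Finset.mem_Ico.2 ⟨s.min'_le i hi, hs _ hmin _ hi⟩
    have := Finset.card_le_card hsub
    rw [Finset.card_image_of_injective _ Fin.val_injective] at this
    simpa using this

/-- Total gap of the contracts posted along an accurate path: the gap `g k` of the contract `k`
lies between `2⁻¹ ^ (l k + 1)` and `2⁻¹ ^ l k`, and the contracts of scale `l` are recognized after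
`q l` plays. -/
theorem sum_gap_le (hC : Function.Injective C) (hT : 1 ≤ T)
    (hacc : Accurate C T D δ u h)
    (hp : ∀ i : Fin n, (h i).1 = posted C i (stage C T D δ h i))
    {g : Fin K → ℝ} {U x : ℝ} (hg : ∀ k, g k = U - u k) (hx : 0 ≤ x)
    (hks : ∀ k, u k ≤ u ks) (hksx : g ks ≤ x / 2) {l : Fin K → ℕ}
    (hl : ∀ k, x < g k → (2⁻¹ : ℝ) ^ (l k + 1) < g k ∧ g k ≤ 2⁻¹ ^ (l k)) {q : ℕ → ℕ}
    (hq : ∀ j, 0 < q j)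
    (hqx : ∀ j, 4 * (Real.sqrt (2 * Real.log T / q j) + δ) ≤ max (2⁻¹ ^ (j + 1)) x / 2)
    (κ : Fin n → Fin K) (hκ : ∀ i, (h i).1 = C (κ i)) :
    ∑ i, g (κ i) ≤ n * x + ∑ k ∈ Finset.univ.filter (fun k => x < g k), g k * q (l k) +
      2 * ((D + 1 + 2 * K : ℕ) : ℝ) := by
  classical
  -- `D + 1` rounds until the plays become usable, at most `K` for the stage at whose end they are
  -- used, and at most `K` for the stage of the later round.
  set W : ℕ := D + 1 + 2 * K with hW
  have hA : ∀ m, (stage C T D δ h m).1.Nonempty := fun m => ⟨ks, best_active hacc hks m⟩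
  set big : Finset (Fin n) := Finset.univ.filter (fun i => x < g (κ i)) with hbig
  set early : Finset (Fin n) := big.filter (fun i => plays h (C (κ i)) i < q (l (κ i)))
    with hearly
  set late : Finset (Fin n) := big.filter (fun i => ¬ plays h (C (κ i)) i < q (l (κ i)))
    with hlate
  have hsplit : ∑ i, g (κ i) = ∑ i ∈ early, g (κ i) + ∑ i ∈ late, g (κ i) +
      ∑ i ∈ Finset.univ.filter (fun i => ¬ x < g (κ i)), g (κ i) := by
    rw [Finset.sum_filter_add_sum_filter_not, Finset.sum_filter_add_sum_filter_not]
  have hsmall : ∑ i ∈ Finset.univ.filter (fun i => ¬ x < g (κ i)), g (κ i) ≤ n * x := by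
    calc _ ≤ ∑ i ∈ Finset.univ.filter (fun i : Fin n => ¬ x < g (κ i)), x := by
          refine Finset.sum_le_sum fun i hi => ?_
          simpa using (Finset.mem_filter.1 hi).2
      _ ≤ n * x := by
          rw [Finset.sum_const, nsmul_eq_mul]
          gcongr
          simpa using Finset.card_filter_le (Finset.univ : Finset (Fin n)) _
  have hE : ∑ i ∈ early, g (κ i) ≤
      ∑ k ∈ Finset.univ.filter (fun k => x < g k), g k * q (l k) := by
    rw [← Finset.sum_fiberwise_of_maps_to (s := early)
      (t := Finset.univ.filter (fun k => x < g k)) (g := κ)]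
    · refine Finset.sum_le_sum fun k hk => ?_
      have hk' := (Finset.mem_filter.1 hk).2
      have hgk : 0 ≤ g k := hx.trans hk'.le
      rw [Finset.sum_congr rfl (g := fun _ => g k)
        (fun i hi => by rw [(Finset.mem_filter.1 hi).2]), Finset.sum_const, nsmul_eq_mul, mul_comm]
      gcongr
      refine (Finset.card_le_card fun i hi => ?_).trans (card_early_le h (C k) (q (l k)))
      obtain ⟨h1, h2⟩ := Finset.mem_filter.1 hi
      have h3 := (Finset.mem_filter.1 h1).2
      rw [h2] at h3
      simp [hκ i, h2, h3]
    · intro i hi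
      have := (Finset.mem_filter.1 (Finset.mem_filter.1 hi).1).2
      simpa using this
  -- At round `i` the posted contract has the fewest plays, hence all active ones have at least `q`.
  -- A survivor at distance `W` has gap at most `g ks` plus half the maximum of `2⁻¹ ^ (l + 1)` and
  -- `x`; as `g ks ≤ x / 2`, this is too small for scale `l`.
  have hclose : ∀ i ∈ late, ∀ j ∈ late, l (κ i) = l (κ j) → (j : ℕ) < i + W := by
    intro i hi j hj hij
    by_contra hcon
    push Not at hcon
    obtain ⟨hib, hiq⟩ := Finset.mem_filter.1 hi
    obtain ⟨hjb, -⟩ := Finset.mem_filter.1 hj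
    have hjx := (Finset.mem_filter.1 hjb).2
    obtain ⟨k, -, hki, hkm⟩ := posted_min_plays hC hA hp i
    have : k = κ i := hC (by rw [← hki, hκ])
    subst this
    obtain ⟨k', hk'A, hkj, -⟩ := posted_min_plays hC hA hp j
    have : k' = κ j := hC (by rw [← hkj, hκ])
    subst this
    have hend := lt_stage_end hA j
    have hcard : (stage C T D δ h j).1.card ≤ K := by
      simpa using Finset.card_le_univ (stage C T D δ h j).1
    have hgap := gap_le_of_active hT hacc hks (hq (l (κ i))) (m := i)
      (fun k hk => (not_lt.1 hiq).trans (hkm k hk)) j (by omega) (κ j) hk'A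
    have h1 := hqx (l (κ i))
    have h2 : max ((2⁻¹ : ℝ) ^ (l (κ i) + 1)) x < g (κ j) := by
      rw [hij]
      exact max_lt (hl _ hjx).1 hjx
    rw [hg ks] at hksx
    rw [hg (κ j)] at h2 hjx
    linarith
  have hL : ∑ i ∈ late, g (κ i) ≤ 2 * (W : ℝ) := by
    obtain ⟨N, hN⟩ : ∃ N, ∀ k, l k < N := by
      refine ⟨Finset.univ.sup l + 1, fun k => ?_⟩
      have := Finset.le_sup (f := l) (Finset.mem_univ k)
      omega
    rw [← Finset.sum_fiberwise_of_maps_to (s := late) (t := Finset.range N)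
      (g := fun i => l (κ i)) (fun i _ => Finset.mem_range.2 (hN _))]
    -- Each scale contributes at most `W` late rounds in total, over all its contracts, which makes
    -- the sum geometric.
    calc _ ≤ ∑ j ∈ Finset.range N, (2⁻¹ : ℝ) ^ j * W := by
          refine Finset.sum_le_sum fun j _ => ?_
          calc _ ≤ ∑ i ∈ late.filter (fun i => l (κ i) = j), (2⁻¹ : ℝ) ^ j := by
                refine Finset.sum_le_sum fun i hi => ?_
                obtain ⟨h1, h2⟩ := Finset.mem_filter.1 hi
                have h3 := (Finset.mem_filter.1 (Finset.mem_filter.1 h1).1).2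
                rw [← h2]
                exact (hl _ h3).2
            _ ≤ _ := by
                rw [Finset.sum_const, nsmul_eq_mul, mul_comm]
                gcongr
                refine card_le_of_diam_lt _ W fun i hi j hj => ?_
                obtain ⟨h1, h2⟩ := Finset.mem_filter.1 hi
                obtain ⟨h3, h4⟩ := Finset.mem_filter.1 hj
                exact hclose i h1 j h3 (h2.trans h4.symm)
      _ ≤ 2 * W := by
          rw [← Finset.sum_mul]
          gcongr
          have := geom_sum_eq (x := (2⁻¹ : ℝ)) (by norm_num) N
          rw [this]
          have : (0 : ℝ) < 2⁻¹ ^ N := by positivity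
          rw [div_le_iff_of_neg (by norm_num)]
          linarith
  rw [hsplit]
  linarith

end Accurate

/-! ### The law of the history and the exponential supermartingale -/

section Law

variable {E : ℝ}

theorem measurable_snoc {t : ℕ} :
    Measurable (fun p : History E t × (unitInterval × Effort E × unitInterval) =>
      (Fin.snoc (α := fun _ => unitInterval × Effort E × unitInterval) p.1 p.2 :
        History E (t + 1))) := by
  refine measurable_pi_iff.2 fun i => ?_
  refine Fin.lastCases ?_ (fun j => ?_) i
  · simpa using measurable_snd
  · simp only [Fin.snoc_castSucc]
    fun_prop

variable (M : Mechanism) (S : Strategy E) (F : Technology E)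

instance isMarkovKernel_roundKernel (t : ℕ) : IsMarkovKernel (roundKernel M S F t) := by
  unfold roundKernel
  infer_instance

instance isProbabilityMeasure_law (t : ℕ) : IsProbabilityMeasure (law M S F t) := by
  induction t with
  | zero => unfold law; infer_instance
  | succ t ih =>
    rw [law]
    exact Measure.isProbabilityMeasure_map measurable_snoc.aemeasurable

theorem lintegral_law_succ {t : ℕ} {f : History E (t + 1) → ℝ≥0∞} (hf : Measurable f) :
    ∫⁻ h, f h ∂law M S F (t + 1) = ∫⁻ h, ∫⁻ p, f (Fin.snoc
      (α := fun _ => unitInterval × Effort E × unitInterval) h p) ∂roundKernel M S F t h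
      ∂law M S F t := by
  rw [law, lintegral_map hf measurable_snoc]
  exact Measure.lintegral_compProd (hf.comp measurable_snoc)

theorem lintegral_roundKernel {t : ℕ} (h : History E t)
    {f : unitInterval × Effort E × unitInterval → ℝ≥0∞} (hf : Measurable f) :
    ∫⁻ p, f p ∂roundKernel M S F t h = ∫⁻ β, ∫⁻ a, ∫⁻ y, f (β, a, y) ∂F.output a
      ∂S.act t (h, β) ∂M.post t (publicPart h) := by
  unfold roundKernel
  rw [Kernel.lintegral_compProd _ _ _ hf]
  refine lintegral_congr fun β => ?_
  have hβ : Measurable fun q : Effort E × unitInterval => f (β, q) :=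
    hf.comp measurable_prodMk_left
  rw [Kernel.lintegral_compProd _ _ _ hβ]
  rfl

/-- The first `m` rounds of a history. -/
def firstRounds {m T : ℕ} (hm : m ≤ T) (h : History E T) : History E m :=
  fun i => h (Fin.castLE hm i)

theorem measurable_firstRounds {m T : ℕ} (hm : m ≤ T) :
    Measurable (firstRounds hm : History E T → History E m) := by
  unfold firstRounds
  fun_prop

/-- Consistency of the finite-horizon laws: later rounds are appended by Markov kernels, which
integrate out to one. -/
theorem law_map_firstRounds {m T : ℕ} (hm : m ≤ T) :
    (law M S F T).map (firstRounds hm) = law M S F m := by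
  induction T with
  | zero =>
    obtain rfl : m = 0 := by omega
    exact Measure.map_id
  | succ T ih =>
    rcases Nat.lt_or_ge T m with h1 | h1
    · obtain rfl : m = T + 1 := by omega
      exact Measure.map_id
    · rw [← ih h1, law, Measure.map_map (measurable_firstRounds hm) measurable_snoc]
      have : (firstRounds hm ∘ fun p : History E T × (unitInterval × Effort E × unitInterval) =>
          (Fin.snoc (α := fun _ => unitInterval × Effort E × unitInterval) p.1 p.2 :
          History E (T + 1))) = firstRounds h1 ∘ Prod.fst := by
        ext1 p
        funext i
        have : Fin.castLE hm i = Fin.castSucc (Fin.castLE h1 i) := rfl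
        simp only [Function.comp, firstRounds, this, Fin.snoc_castSucc]
      rw [this, ← Measure.map_map (measurable_firstRounds h1) measurable_fst]
      congr 1
      exact Measure.fst_compProd _ _

theorem lintegral_law_round {T : ℕ} (i : Fin T)
    {f : unitInterval × Effort E × unitInterval → ℝ≥0∞} (hf : Measurable f) :
    ∫⁻ h, f (h i) ∂law M S F T =
      ∫⁻ h, ∫⁻ p, f p ∂roundKernel M S F i h ∂law M S F i := by
  have hfi : Measurable fun h : History E (i + 1) => f (h (Fin.last i)) :=
    hf.comp (measurable_pi_apply _)
  have h1 : ∫⁻ h, f (h i) ∂law M S F T =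
      ∫⁻ h, f (h (Fin.last i)) ∂law M S F (i + 1) := by
    rw [← law_map_firstRounds M S F (m := i + 1) (T := T) i.2,
      lintegral_map hfi (measurable_firstRounds _)]
    rfl
  rw [h1, lintegral_law_succ M S F hfi]
  simp

theorem integral_law_last {T : ℕ} (i : Fin T)
    {f : unitInterval × Effort E × unitInterval → ℝ} (hf : Measurable f) :
    ∫ h, f (h i) ∂law M S F T = ∫ h, f (h (Fin.last i)) ∂law M S F (i + 1) := by
  have hfi : Measurable fun h : History E (i + 1) => f (h (Fin.last i)) :=
    hf.comp (measurable_pi_apply _)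
  rw [← law_map_firstRounds M S F (m := i + 1) (T := T) i.2,
    integral_map (measurable_firstRounds _).aemeasurable hfi.aestronglyMeasurable]
  rfl

theorem integral_law_round {T : ℕ} (i : Fin T)
    {f : unitInterval × Effort E × unitInterval → ℝ} (hf : Measurable f) {B : ℝ}
    (hB : ∀ p, |f p| ≤ B) :
    ∫ h, f (h i) ∂law M S F T =
      ∫ h, ∫ p, f p ∂roundKernel M S F i h ∂law M S F i := by
  have hfi : Measurable fun h : History E (i + 1) => f (h (Fin.last i)) :=
    hf.comp (measurable_pi_apply _)
  rw [integral_law_last M S F i hf, law, integral_map measurable_snoc.aemeasurable hfi.aestronglyMeasurable, Measure.integral_compProd]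
  · simp
  · refine Integrable.of_bound
      (hfi.comp measurable_snoc).aestronglyMeasurable B ?_
    exact Eventually.of_forall fun p => by simpa using hB _

theorem ae_law_round {T : ℕ} (i : Fin T) {q : unitInterval × Effort E × unitInterval → Prop}
    (hm : MeasurableSet {p | q p}) (hq : ∀ h, ∀ᵐ p ∂roundKernel M S F i h, q p) :
    ∀ᵐ h ∂law M S F T, q (h i) := by
  have hi : Measurable fun h : History E T => h i := measurable_pi_apply i
  have hmi : MeasurableSet {h : History E T | ¬ q (h i)} := hi hm.compl
  have := lintegral_law_round M S F i (measurable_one.indicator hm.compl)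
  rw [ae_iff, ← lintegral_indicator_one hmi]
  refine Eq.trans this ?_
  rw [lintegral_eq_zero_iff' ?_]
  · refine Eventually.of_forall fun h => ?_
    simp only [lintegral_indicator_one hm.compl]
    exact ae_iff.1 (hq h)
  · exact ((measurable_one.indicator hm.compl).lintegral_kernel
      (κ := roundKernel M S F i)).aemeasurable

theorem integral_roundKernel {t : ℕ} (h : History E t)
    {f : unitInterval × Effort E × unitInterval → ℝ} (hf : Measurable f) {B : ℝ}
    (hB : ∀ p, |f p| ≤ B) :
    ∫ p, f p ∂roundKernel M S F t h = ∫ β, ∫ a, ∫ y, f (β, a, y) ∂F.output a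
      ∂S.act t (h, β) ∂M.post t (publicPart h) := by
  unfold roundKernel
  rw [integral_compProd]
  · refine integral_congr_ae (Eventually.of_forall fun β => ?_)
    beta_reduce
    rw [integral_compProd]
    · rfl
    · exact Integrable.of_bound (hf.comp measurable_prodMk_left).aestronglyMeasurable B
        (Eventually.of_forall fun p => hB _)
  · exact Integrable.of_bound hf.aestronglyMeasurable B (Eventually.of_forall fun p => hB _)

/-- Given the contract and the effort, the output has mean equal to the effort. -/
theorem integral_round_mul_output {T : ℕ} (i : Fin T) {w : unitInterval → Effort E → ℝ}
    (hw : Measurable (Function.uncurry w)) {B : ℝ} (hB : ∀ β a, |w β a| ≤ B) :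
    ∫ h, w (h i).1 (h i).2.1 * ((h i).2.2 : ℝ) ∂law M S F T =
      ∫ h, w (h i).1 (h i).2.1 * ((h i).2.1 : ℝ) ∂law M S F T := by
  have hw' : Measurable fun p : unitInterval × Effort E × unitInterval => w p.1 p.2.1 :=
    hw.comp (measurable_fst.prodMk measurable_snd.fst)
  have hE : ∀ a : Effort E, |(a : ℝ)| ≤ |E| := fun a => abs_le_abs_of_nonneg a.2.1 a.2.2
  -- The sign of `E` is not assumed here; without effort levels there are no histories, and
  -- otherwise `B` is nonnegative.
  rcases isEmpty_or_nonempty (Effort E) with he | ⟨⟨a0⟩⟩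
  · have : IsEmpty (History E T) := ⟨fun h => he.elim (h i).2.1⟩
    simp [Measure.eq_zero_of_isEmpty (law M S F T)]
  have hB0 : 0 ≤ B := (abs_nonneg _).trans (hB 0 a0)
  have h1 := integral_law_round M S F i
    (f := fun p => w p.1 p.2.1 * (p.2.2 : ℝ)) (by fun_prop) (B := B) (fun p => by
      rw [abs_mul, abs_of_nonneg p.2.2.2.1]
      exact (mul_le_of_le_one_right (abs_nonneg _) p.2.2.2.2).trans (hB _ _))
  have h2 := integral_law_round M S F i
    (f := fun p => w p.1 p.2.1 * (p.2.1 : ℝ)) (by fun_prop) (B := B * |E|) (fun p => by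
      rw [abs_mul]
      exact mul_le_mul (hB _ _) (hE _) (abs_nonneg _) hB0)
  rw [h1, h2]
  refine integral_congr_ae (Eventually.of_forall fun h => ?_)
  simp only
  rw [integral_roundKernel M S F h
      (f := fun p => w p.1 p.2.1 * (p.2.2 : ℝ)) (by fun_prop) (B := B) (fun p => by
      rw [abs_mul, abs_of_nonneg p.2.2.2.1]
      exact (mul_le_of_le_one_right (abs_nonneg _) p.2.2.2.2).trans (hB _ _)),
    integral_roundKernel M S F h
      (f := fun p => w p.1 p.2.1 * (p.2.1 : ℝ)) (by fun_prop) (B := B * |E|) (fun p => by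
      rw [abs_mul]
      exact mul_le_mul (hB _ _) (hE _) (abs_nonneg _) hB0)]
  refine integral_congr_ae (Eventually.of_forall fun β => ?_)
  refine integral_congr_ae (Eventually.of_forall fun a => ?_)
  simp only [integral_const_mul, F.mean_output]
  simp

/-- Exponential supermartingale of the centred outputs of the contract `b`. -/
theorem lintegral_exp_centered_le_one (s : ℝ) (b : unitInterval) (m t : ℕ) :
    ∫⁻ h, ENNReal.ofReal (Real.exp (∑ τ : Fin t, if (τ : ℕ) < m ∧ (h τ).1 = b then
      s * (((h τ).2.2 : ℝ) - ((h τ).2.1 : ℝ)) - s ^ 2 / 8 else 0)) ∂law M S F t ≤ 1 := by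
  have hmeas : ∀ j : ℕ, Measurable fun p : unitInterval × Effort E × unitInterval =>
      if j < m ∧ p.1 = b then s * ((p.2.2 : ℝ) - (p.2.1 : ℝ)) - s ^ 2 / 8 else 0 := fun j =>
    Measurable.ite (measurableSet_and (measurableSet_prop _)
      (measurable_fst (measurableSet_singleton b))) (by fun_prop) measurable_const
  induction t with
  | zero => simp
  | succ t ih =>
    have hm : Measurable fun h : History E (t + 1) => ENNReal.ofReal (Real.exp
        (∑ τ : Fin (t + 1), if (τ : ℕ) < m ∧ (h τ).1 = b then
          s * (((h τ).2.2 : ℝ) - ((h τ).2.1 : ℝ)) - s ^ 2 / 8 else 0)) := by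
      refine (Real.measurable_exp.comp (Finset.measurable_sum _ fun τ _ => ?_)).ennreal_ofReal
      exact (hmeas τ).comp (measurable_pi_apply τ)
    rw [lintegral_law_succ M S F hm]
    refine le_trans (lintegral_mono fun h => ?_) ih
    simp only [Fin.sum_univ_castSucc, Fin.snoc_castSucc, Fin.snoc_last, Real.exp_add,
      Fin.val_castSucc, Fin.val_last,
      ENNReal.ofReal_mul (Real.exp_nonneg _)]
    have hexp : Measurable fun p : unitInterval × Effort E × unitInterval => ENNReal.ofReal
        (Real.exp (if t < m ∧ p.1 = b then s * ((p.2.2 : ℝ) - (p.2.1 : ℝ)) - s ^ 2 / 8 else 0)) :=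
      (Real.measurable_exp.comp (hmeas t)).ennreal_ofReal
    rw [lintegral_const_mul _ hexp]
    refine mul_le_of_le_one_right zero_le ?_
    rw [lintegral_roundKernel M S F h hexp]
    have inner : ∀ β a, ∫⁻ y : unitInterval, ENNReal.ofReal (Real.exp
        (if t < m ∧ β = b then s * ((y : ℝ) - (a : ℝ)) - s ^ 2 / 8 else 0)) ∂F.output a ≤ 1 := by
      intro β a
      by_cases hβ : t < m ∧ β = b
      · simp only [if_pos hβ]
        -- Hoeffding's lemma on `[0,1]`: variance proxy `1 / 4`, so the compensator is `s ^ 2 / 8`.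
        have hsub := hasSubgaussianMGF_of_mem_Icc (μ := F.output a)
          (X := fun y : unitInterval => (y : ℝ)) (a := 0) (b := 1)
          measurable_subtype_coe.aemeasurable (Eventually.of_forall fun y => y.2)
        rw [F.mean_output] at hsub
        have hle := hsub.mgf_le s
        rw [← ofReal_integral_eq_lintegral_ofReal]
        · rw [← ENNReal.ofReal_one]
          refine ENNReal.ofReal_le_ofReal ?_
          simp only [sub_eq_add_neg _ (s ^ 2 / 8), Real.exp_add]
          rw [integral_mul_const]
          have : Real.exp (-(s ^ 2 / 8)) = (Real.exp (s ^ 2 / 8))⁻¹ := Real.exp_neg _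
          rw [this, ← div_eq_mul_inv, div_le_one (Real.exp_pos _)]
          refine hle.trans (le_of_eq ?_)
          congr 1
          simp
          ring
        · simp only [sub_eq_add_neg _ (s ^ 2 / 8), Real.exp_add]
          exact (hsub.integrable_exp_mul s).mul_const _
        · exact Eventually.of_forall fun y => (Real.exp_pos _).le
      · simp [hβ]
    calc _ ≤ ∫⁻ _β, ∫⁻ _a, 1 ∂S.act t (h, _β) ∂M.post t (publicPart h) :=
          lintegral_mono fun β => lintegral_mono fun a => inner β a
      _ = 1 := by simp

end Law

/-! ### The delay: contracts are determined many rounds ahead -/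

section Delay

variable {K : ℕ} (C : Fin K → unitInterval) (T D : ℕ) (δ : ℝ)

/-- For such `t`, the constraint `τ + 1 + D < t` forces `τ < b`, so no sample is lost by truncating
the history. -/
theorem samples_castLE {b n t : ℕ} (hb : b ≤ n) (h : PublicHistory n) (β : unitInterval)
    (ht : t ≤ b + D + 1) :
    samples D t h β =
      (samples D t (fun i => h (Fin.castLE hb i) : PublicHistory b) β).map
        (Fin.castLEEmb hb) := by
  ext τ
  simp only [samples, Finset.mem_filter, Finset.mem_univ, true_and, Finset.mem_map]
  constructor
  · rintro ⟨h1, h2⟩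
    exact ⟨⟨τ, by omega⟩, ⟨h1, h2⟩, rfl⟩
  · rintro ⟨σ, h1, rfl⟩
    exact h1

/-- Because of the delay, the stage of a round depends only on rounds that are `D + 1` rounds
back. -/
theorem stage_castLE {b n : ℕ} (hb : b ≤ n) (h : PublicHistory n) (m : ℕ) (hm : m ≤ b + D + 1) :
    stage C T D δ h m = stage C T D δ (fun i => h (Fin.castLE hb i) : PublicHistory b) m := by
  induction m with
  | zero => rfl
  | succ m ih =>
    have ih := ih (by omega)
    have hle := stage_start_le C T D δ h m
    have hs : ∀ β, samples D (stage C T D δ h m).2 h β = _ := fun β =>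
      samples_castLE D hb h β (t := (stage C T D δ h m).2) (by omega)
    have hsurv : ∀ A, survivors C T D δ (stage C T D δ h m).2 h A =
        survivors C T D δ (stage C T D δ h m).2
          (fun i => h (Fin.castLE hb i) : PublicHistory b) A := by
      intro A
      unfold survivors Beats meanUtility radius
      simp only [hs, Finset.sum_map, Finset.card_map, Finset.map_nonempty, Fin.castLEEmb_apply]
    by_cases hmm : m + 1 < (stage C T D δ h m).2 + (stage C T D δ h m).1.card
    · rw [stage_succ_of_lt C T D δ h hmm]
      rw [ih] at hmm ⊢
      rw [stage_succ_of_lt C T D δ _ hmm]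
    · rw [stage_succ_of_not_lt C T D δ h hmm, hsurv]
      rw [ih] at hmm ⊢
      rw [stage_succ_of_not_lt C T D δ _ hmm]

variable {E : ℝ} (S : Strategy E) (F : Technology E)

theorem ae_roundKernel_posted {t : ℕ} (h : History E t) :
    ∀ᵐ p ∂roundKernel (delayedElimination C T D δ) S F t h,
      p.1 = posted C t (stage C T D δ (publicPart h) t) := by
  have hm : MeasurableSet {p : unitInterval × Effort E × unitInterval |
      ¬ p.1 = posted C t (stage C T D δ (publicPart h) t)} :=
    (measurable_fst (measurableSet_singleton _)).compl
  rw [ae_iff, ← lintegral_indicator_one hm,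
    lintegral_roundKernel _ _ _ _ (measurable_one.indicator hm)]
  simp [delayedElimination, Kernel.deterministic_apply, Set.indicator]

/-- Almost surely, every round follows the mechanism. -/
theorem ae_posted (n : ℕ) :
    ∀ᵐ h ∂law (delayedElimination C T D δ) S F n,
      ∀ i : Fin n, (h i).1 = posted C i (stage C T D δ (publicPart h) i) := by
  rw [ae_all_iff]
  intro i
  have key : ∀ᵐ h ∂law (delayedElimination C T D δ) S F (i + 1),
      (h (Fin.last i)).1 = posted C i (stage C T D δ
        (publicPart (firstRounds (Nat.le_succ i) h)) i) := by
    have hms : MeasurableSet {h : History E (i + 1) | (h (Fin.last i)).1 = posted C i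
        (stage C T D δ (publicPart (firstRounds (Nat.le_succ i) h)) i)} :=
      measurableSet_eq_fun (measurable_fst.comp (measurable_pi_apply _))
        ((measurable_posted_stage C T D δ).comp
          (measurable_publicPart.comp (measurable_firstRounds _)))
    rw [law, ae_map_iff measurable_snoc.aemeasurable hms]
    refine Measure.ae_compProd_of_ae_ae (measurable_snoc hms) ?_
    refine Eventually.of_forall fun h => ?_
    filter_upwards [ae_roundKernel_posted C T D δ S F h] with p hp
    rw [Fin.snoc_last, hp]
    congr 4
    funext j
    have : Fin.castLE (Nat.le_succ i) j = Fin.castSucc j := rfl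
    simp only [firstRounds, this, Fin.snoc_castSucc]
  rw [← law_map_firstRounds _ S F (m := i + 1) (T := n) i.2] at key
  filter_upwards [ae_of_ae_map (measurable_firstRounds _).aemeasurable key] with h hh
  rw [stage_castLE C T D δ i.2.le (publicPart h) i (by omega)]
  exact hh

end Delay

/-! ### Concentration of the observed utilities -/

section Concentration

variable {K : ℕ} {C : Fin K → unitInterval} {T D : ℕ} {δ : ℝ} {E : ℝ}

/-- Chernoff bound: Markov's inequality for the exponential supermartingale, whose expectation is at
most one. -/
theorem measure_centered_ge_le (M : Mechanism) (S : Strategy E) (F : Technology E) (s : ℝ)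
    (b : unitInterval) (m t : ℕ) (r : ℝ) :
    law M S F t {h | r ≤ ∑ τ : Fin t, if (τ : ℕ) < m ∧ (h τ).1 = b then
      s * (((h τ).2.2 : ℝ) - ((h τ).2.1 : ℝ)) - s ^ 2 / 8 else 0} ≤
      ENNReal.ofReal (Real.exp (-r)) := by
  have hmeas : Measurable fun h : History E t => ∑ τ : Fin t, if (τ : ℕ) < m ∧ (h τ).1 = b then
      s * (((h τ).2.2 : ℝ) - ((h τ).2.1 : ℝ)) - s ^ 2 / 8 else 0 := by
    refine Finset.measurable_sum _ fun τ _ => ?_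
    have hτ : Measurable fun h : History E t => (h τ).1 :=
      measurable_fst.comp (measurable_pi_apply τ)
    exact Measurable.ite (measurableSet_and (measurableSet_prop _)
      (hτ (measurableSet_singleton b))) (by fun_prop) measurable_const
  have h1 := meas_ge_le_lintegral_div (μ := law M S F t)
    (Real.measurable_exp.comp hmeas).ennreal_ofReal.aemeasurable (ε := ENNReal.ofReal (Real.exp r))
    (by simpa using Real.exp_pos r) ENNReal.ofReal_ne_top
  have h2 := lintegral_exp_centered_le_one M S F s b m t
  refine (measure_mono fun h hh => ?_).trans (h1.trans ((ENNReal.div_le_div_right h2 _).trans ?_))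
  · exact ENNReal.ofReal_le_ofReal (Real.exp_le_exp.2 hh)
  · rw [one_div, ← ENNReal.ofReal_inv_of_pos (Real.exp_pos r), Real.exp_neg]

/-- The exponent used for `q` samples. -/
noncomputable def tilt (T q : ℕ) : ℝ := 4 * Real.sqrt (2 * Real.log T / q)

/-- Some average of the centred outputs leaves its confidence interval. -/
def deviationEvent (E : ℝ) (C : Fin K → unitInterval) (T : ℕ) : Set (History E T) :=
  ⋃ m ∈ Finset.range (T + 1), ⋃ k : Fin K, ⋃ q ∈ Finset.range (T + 1),
    ⋃ e ∈ ({1, -1} : Finset ℝ),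
    {h | 4 * Real.log T ≤ ∑ τ : Fin T, if (τ : ℕ) < m ∧ (h τ).1 = C k then
      (e * tilt T q) * (((h τ).2.2 : ℝ) - ((h τ).2.1 : ℝ)) - (e * tilt T q) ^ 2 / 8 else 0}

theorem measure_deviationEvent_le (M : Mechanism) (S : Strategy E) (F : Technology E)
    (C : Fin K → unitInterval) (T : ℕ) :
    law M S F T (deviationEvent E C T) ≤
      ((T + 1) * (K * ((T + 1) * 2))) * ENNReal.ofReal (Real.exp (-(4 * Real.log T))) := by
  unfold deviationEvent
  set x := ENNReal.ofReal (Real.exp (-(4 * Real.log T)))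
  calc _ ≤ ∑ m ∈ Finset.range (T + 1), ∑ k : Fin K, ∑ q ∈ Finset.range (T + 1),
        ∑ e ∈ ({1, -1} : Finset ℝ), x := by
        refine (measure_biUnion_finset_le _ _).trans (Finset.sum_le_sum fun m _ => ?_)
        refine (measure_iUnion_fintype_le _ _).trans (Finset.sum_le_sum fun k _ => ?_)
        refine (measure_biUnion_finset_le _ _).trans (Finset.sum_le_sum fun q _ => ?_)
        refine (measure_biUnion_finset_le _ _).trans (Finset.sum_le_sum fun e _ => ?_)
        exact measure_centered_ge_le M S F _ _ _ _ _
    _ = _ := by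
        have : ({1, -1} : Finset ℝ).card = 2 := Finset.card_pair (by norm_num)
        simp only [Finset.sum_const, this, Finset.card_range, Finset.card_univ, Fintype.card_fin,
          nsmul_eq_mul]
        push_cast
        ring

/-- Outside of the deviation event, if all efforts are `δ`-close to the myopic ones, all
confidence intervals are correct. -/
theorem accurate_of_notMem (hT : 3 ≤ T) {a : ℝ → ℝ} {h : History E T}
    (hdev : h ∉ deviationEvent E C T)
    (heff : ∀ i, |((h i).2.1 : ℝ) - a (h i).1| ≤ δ) :
    Accurate C T D δ (fun k => truthfulUtility a (C k)) (publicPart h) := by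
  intro t k hne
  set β := C k with hβ
  set s := samples D t (publicPart h) β with hs
  have hcard : 0 < s.card := Finset.card_pos.2 hne
  have hq : (0 : ℝ) < s.card := by exact_mod_cast hcard
  have hmem : ∀ τ ∈ s, (h τ).1 = β := fun τ hτ => (Finset.mem_filter.1 hτ).2.2
  have hlog : 0 < Real.log T := Real.log_pos (by exact_mod_cast (by omega : 1 < T))
  set r := Real.sqrt (2 * Real.log T / s.card) with hr
  have hr0 : 0 < r := Real.sqrt_pos.2 (by positivity)
  have hr2 : r ^ 2 * s.card = 2 * Real.log T := by
    rw [hr, Real.sq_sqrt (by positivity)]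
    field_simp
  -- Capping at `T` changes no sample and keeps the time index in the finite range of the union
  -- bound, whereas `t` is arbitrary.
  have hsum : ∀ x : ℝ, (∑ τ : Fin T, if (τ : ℕ) < min (t - 1 - D) T ∧ (h τ).1 = β then
      x * (((h τ).2.2 : ℝ) - ((h τ).2.1 : ℝ)) - x ^ 2 / 8 else 0) =
      x * (∑ τ ∈ s, (((h τ).2.2 : ℝ) - ((h τ).2.1 : ℝ))) - s.card * (x ^ 2 / 8) := by
    intro x
    rw [← Finset.sum_filter, Finset.sum_congr (s₂ := s) _ (fun _ _ => rfl),
      Finset.sum_sub_distrib, Finset.mul_sum, Finset.sum_const, nsmul_eq_mul]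
    ext τ
    rw [hs]
    unfold samples publicPart
    simp only [Finset.mem_filter, Finset.mem_univ, true_and]
    have := τ.2
    constructor <;> rintro ⟨h1, h2⟩ <;> exact ⟨by omega, h2⟩
  have hcardT : s.card ≤ T := by simpa using Finset.card_le_univ s
  -- The sample size is random; since the deviation event covers all sizes, the tilt can be matched
  -- to the realized one.
  have hnot : ∀ e ∈ ({1, -1} : Finset ℝ), (e * tilt T s.card) *
      (∑ τ ∈ s, (((h τ).2.2 : ℝ) - ((h τ).2.1 : ℝ))) -
        s.card * ((e * tilt T s.card) ^ 2 / 8) < 4 * Real.log T := by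
    intro e he
    by_contra hcon
    push Not at hcon
    rw [← hsum] at hcon
    refine hdev ?_
    unfold deviationEvent
    simp only [Set.mem_iUnion]
    exact ⟨min (t - 1 - D) T, by simp, k, s.card,
      by simpa using Nat.lt_succ_of_le hcardT, e, he, hcon⟩
  have htilt : tilt T s.card = 4 * r := rfl
  rw [htilt] at hnot
  have hp := hnot 1 (by simp)
  have hn := hnot (-1) (by simp)
  set X := ∑ τ ∈ s, (((h τ).2.2 : ℝ) - ((h τ).2.1 : ℝ)) with hX
  -- With `n = s.card` and `n * r ^ 2 = 2 * log T`, the optimal tilt `4 * r` gives exponent `4 * r *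
  -- X - 4 * log T`, which exceeds `4 * log T` once `X > n * r`; the other sign is symmetric.
  have hXabs : |X| ≤ s.card * r := by
    rw [abs_le]
    constructor
    · by_contra hcon
      push Not at hcon
      nlinarith
    · by_contra hcon
      push Not at hcon
      nlinarith
  have hY : |∑ τ ∈ s, (((h τ).2.1 : ℝ) - a β)| ≤ s.card * δ := by
    refine (Finset.abs_sum_le_sum_abs _ _).trans ?_
    rw [← nsmul_eq_mul, ← Finset.sum_const]
    refine Finset.sum_le_sum fun τ hτ => ?_
    have := heff τ
    rwa [hmem τ hτ] at this
  have hmean : meanUtility D t (publicPart h) β - truthfulUtility a β =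
      (1 - (β : ℝ)) * ((X + ∑ τ ∈ s, (((h τ).2.1 : ℝ) - a β)) / s.card) := by
    unfold meanUtility truthfulUtility publicPart
    rw [hX, ← Finset.sum_add_distrib]
    simp only [sub_add_sub_cancel]
    rw [Finset.sum_sub_distrib, Finset.sum_const, nsmul_eq_mul, ← Finset.mul_sum]
    change (1 - (β : ℝ)) * (∑ τ ∈ s, ((h τ).2.2 : ℝ)) / (s.card : ℝ) - _ = _
    field_simp
  have hβ0 : 0 ≤ 1 - (β : ℝ) := by linarith [β.2.2]
  have hβ1 : 1 - (β : ℝ) ≤ 1 := by linarith [β.2.1]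
  change |meanUtility D t (publicPart h) β - truthfulUtility a β| ≤ r + δ
  rw [hmean, abs_mul, abs_of_nonneg hβ0]
  refine (mul_le_of_le_one_left (abs_nonneg _) hβ1).trans ?_
  rw [abs_div, abs_of_pos hq, div_le_iff₀ hq]
  refine (abs_add_le _ _).trans ?_
  linarith

end Concentration

/-! ### Myopic best responses under strong convexity -/

section Myopic

variable {E : ℝ} {c a : ℝ → ℝ}

/-- The two optimality inequalities add up to `(β' - β) * (a β' - a β) ≥ 0`. Monotonicity also
supplies the measurability of the selection `a`. -/
theorem IsBestResponse.monotoneOn (hbr : IsBestResponse E c a) :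
    MonotoneOn a (Set.Icc (0 : ℝ) 1) := by
  intro β hβ β' hβ' hle
  rcases hle.eq_or_lt with rfl | hlt
  · exact le_rfl
  have h1 := (hbr β hβ).2 _ (hbr β' hβ').1
  have h2 := (hbr β' hβ').2 _ (hbr β hβ).1
  by_contra hcon
  push Not at hcon
  nlinarith

/-- The myopic best response as an effort level. -/
def bestEffort (hbr : IsBestResponse E c a) (β : unitInterval) : Effort E :=
  ⟨a β, (hbr β β.2).1⟩

theorem measurable_bestEffort (hbr : IsBestResponse E c a) : Measurable (bestEffort hbr) :=
  Monotone.measurable fun β β' hle => hbr.monotoneOn β.2 β'.2 hle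

theorem measurable_cost (hc : MonotoneOn c (Set.Icc (0 : ℝ) E)) :
    Measurable fun x : Effort E => c x :=
  Monotone.measurable fun x x' hle => hc x.2 x'.2 hle

/-- One-round utility of the agent. -/
def payoff (c : ℝ → ℝ) (β : unitInterval) (x : Effort E) : ℝ := (β : ℝ) * x - c x

theorem payoff_le_best (hbr : IsBestResponse E c a) (β : unitInterval) (x : Effort E) :
    payoff c β x ≤ payoff c β (bestEffort hbr β) := (hbr β β.2).2 x x.2

/-- Compare `a β` with the midpoint of `x` and `a β`: strong convexity gains `lam / 8 * (x - a β) ^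
2` over the average of the endpoint values, and optimality of `a β` doubles this. -/
theorem quadratic_le_loss {lam : ℝ} (hbr : IsBestResponse E c a)
    (hsc : StrongConvexOn (Set.Icc (0 : ℝ) E) lam c) {β : ℝ} (hβ : β ∈ Set.Icc (0 : ℝ) 1) {x : ℝ}
    (hx : x ∈ Set.Icc (0 : ℝ) E) :
    lam / 4 * (x - a β) ^ 2 ≤ (β * a β - c (a β)) - (β * x - c x) := by
  have ha := (hbr β hβ).1
  have hsc' := (show UniformConvexOn _ _ _ from hsc).2
  have h1 := hsc' hx ha (a := 1 / 2) (b := 1 / 2) (by norm_num) (by norm_num) (by norm_num)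
  have h2 := (hbr β hβ).2 (1 / 2 * x + 1 / 2 * a β)
    ⟨by linarith [hx.1, ha.1], by linarith [hx.2, ha.2]⟩
  simp only [smul_eq_mul, Real.norm_eq_abs, sq_abs] at h1
  nlinarith

/-- Add the quadratic loss bounds of each response under the other contract; the costs cancel. This
is the source of the continuity of the utility. -/
theorem lipschitz_bestResponse {lam : ℝ} (hlam : 0 < lam) (hbr : IsBestResponse E c a)
    (hsc : StrongConvexOn (Set.Icc (0 : ℝ) E) lam c) {β β' : ℝ} (hβ : β ∈ Set.Icc (0 : ℝ) 1)
    (hβ' : β' ∈ Set.Icc (0 : ℝ) 1) : |a β - a β'| ≤ 2 / lam * |β - β'| := by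
  have h1 := quadratic_le_loss hbr hsc hβ (hbr β' hβ').1
  have h2 := quadratic_le_loss hbr hsc hβ' (hbr β hβ).1
  have h3 : lam / 2 * |a β - a β'| ^ 2 ≤ |β - β'| * |a β - a β'| := by
    rw [← abs_mul, sq_abs]
    refine le_trans ?_ (le_abs_self _)
    nlinarith
  rcases (abs_nonneg (a β - a β')).eq_or_lt with h0 | h0
  · rw [← h0]; positivity
  · have h4 : lam / 2 * |a β - a β'| ≤ |β - β'| := by
      by_contra hcon
      push Not at hcon
      nlinarith
    rw [div_mul_eq_mul_div, le_div_iff₀ hlam]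
    linarith

end Myopic

/-! ### Incentives: an optimal agent is nearly myopic -/

section Incentive

variable {E : ℝ} {c a : ℝ → ℝ}

theorem abs_cost_le (hc : MonotoneOn c (Set.Icc (0 : ℝ) E)) (hc0 : c 0 = 0) (hE : 0 ≤ E)
    (x : Effort E) : |c x| ≤ c E := by
  have h1 := hc ⟨le_rfl, hE⟩ x.2 x.2.1
  rw [hc0] at h1
  rw [abs_of_nonneg h1]
  exact hc x.2 ⟨hE, le_rfl⟩ x.2.2

theorem cost_nonneg (hc : MonotoneOn c (Set.Icc (0 : ℝ) E)) (hc0 : c 0 = 0) (hE : 0 ≤ E)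
    (x : Effort E) : 0 ≤ c x := by
  have h1 := hc ⟨le_rfl, hE⟩ x.2 x.2.1
  rwa [hc0] at h1

theorem measurable_payoff (hc : MonotoneOn c (Set.Icc (0 : ℝ) E)) :
    Measurable (Function.uncurry (payoff (E := E) c)) := by
  have : Measurable fun p : unitInterval × Effort E => c p.2 :=
    (measurable_cost hc).comp measurable_snd
  unfold Function.uncurry payoff
  exact ((measurable_subtype_coe.comp measurable_fst).mul
    (measurable_subtype_coe.comp measurable_snd)).sub this

theorem abs_payoff_le (hc : MonotoneOn c (Set.Icc (0 : ℝ) E)) (hc0 : c 0 = 0) (hE : 0 ≤ E)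
    (β : unitInterval) (x : Effort E) : |payoff c β x| ≤ E + c E := by
  have h1 := abs_cost_le hc hc0 hE x
  have h2 : |(β : ℝ) * x| ≤ E := by
    rw [abs_of_nonneg (mul_nonneg β.2.1 x.2.1)]
    exact (mul_le_of_le_one_left x.2.1 β.2.2).trans x.2.2
  exact (abs_sub _ _).trans (add_le_add h2 h1)

theorem payoff_best_nonneg (hc0 : c 0 = 0) (hE : 0 ≤ E) (hbr : IsBestResponse E c a)
    (β : unitInterval) : 0 ≤ payoff c β (bestEffort hbr β) := by
  have := (hbr β β.2).2 0 ⟨le_rfl, hE⟩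
  simp only [mul_zero, hc0, sub_zero] at this
  exact this

variable (M : Mechanism) (S : Strategy E) (F : Technology E)

/-- Expected utility of the agent in one round. -/
noncomputable def roundPayoff (c : ℝ → ℝ) (M : Mechanism) (S : Strategy E) (F : Technology E)
    {T : ℕ} (i : Fin T) : ℝ := ∫ h, payoff c (h i).1 (h i).2.1 ∂law M S F T

theorem measurable_payoff_round (hc : MonotoneOn c (Set.Icc (0 : ℝ) E)) :
    Measurable fun p : unitInterval × Effort E × unitInterval => payoff c p.1 p.2.1 :=
  (measurable_payoff hc).comp (measurable_fst.prodMk measurable_snd.fst)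

theorem integrable_payoff (hc : MonotoneOn c (Set.Icc (0 : ℝ) E)) (hc0 : c 0 = 0) (hE : 0 ≤ E)
    {T : ℕ} (i : Fin T) : Integrable (fun h => payoff c (h i).1 (h i).2.1) (law M S F T) :=
  Integrable.of_bound ((measurable_payoff_round hc).comp
    (measurable_pi_apply i)).aestronglyMeasurable (E + c E)
    (Eventually.of_forall fun _ => abs_payoff_le hc hc0 hE _ _)

theorem measurable_payoff_best (hc : MonotoneOn c (Set.Icc (0 : ℝ) E))
    (hbr : IsBestResponse E c a) : Measurable fun β => payoff c β (bestEffort hbr β) :=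
  (measurable_payoff hc).comp (measurable_id.prodMk (measurable_bestEffort hbr))

theorem integrable_payoff_best (hc : MonotoneOn c (Set.Icc (0 : ℝ) E)) (hc0 : c 0 = 0)
    (hE : 0 ≤ E) (hbr : IsBestResponse E c a) {T : ℕ} (i : Fin T) :
    Integrable (fun h => payoff c (h i).1 (bestEffort hbr (h i).1)) (law M S F T) := by
  have hi : Measurable fun h : History E T => (h i).1 := (measurable_pi_apply i).fst
  exact Integrable.of_bound ((measurable_payoff_best hc hbr).comp hi).aestronglyMeasurable
    (E + c E) (Eventually.of_forall fun _ => abs_payoff_le hc hc0 hE _ _)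

/-- Outputs are replaced by their conditional means, the efforts, so that rounds can be compared
through `payoff` alone. -/
theorem agentValue_eq_sum (hc : MonotoneOn c (Set.Icc (0 : ℝ) E)) (hc0 : c 0 = 0) (hE : 0 ≤ E)
    (γ : ℝ) (T : ℕ) :
    agentValue c γ T F M S = ∑ i : Fin T, γ ^ ((i : ℕ) + 1) * roundPayoff c M S F i := by
  have hcost : ∀ i : Fin T, Measurable fun h : History E T => c (h i).2.1 := fun i =>
    (measurable_cost hc).comp (measurable_pi_apply i).snd.fst
  have hicost : ∀ i : Fin T, Integrable (fun h => c (h i).2.1) (law M S F T) := fun i =>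
    Integrable.of_bound (hcost i).aestronglyMeasurable (c E)
      (Eventually.of_forall fun _ => abs_cost_le hc hc0 hE _)
  have hiy : ∀ i : Fin T, Integrable (fun h : History E T => ((h i).1 : ℝ) * ((h i).2.2 : ℝ))
      (law M S F T) := fun i => by
    refine Integrable.of_bound (by fun_prop) 1 (Eventually.of_forall fun h => ?_)
    rw [Real.norm_eq_abs, abs_of_nonneg (mul_nonneg (h i).1.2.1 (h i).2.2.2.1)]
    exact mul_le_one₀ (h i).1.2.2 (h i).2.2.2.1 (h i).2.2.2.2
  have hia : ∀ i : Fin T, Integrable (fun h : History E T => ((h i).1 : ℝ) * ((h i).2.1 : ℝ))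
      (law M S F T) := fun i => by
    refine Integrable.of_bound (by fun_prop) E (Eventually.of_forall fun h => ?_)
    rw [Real.norm_eq_abs, abs_of_nonneg (mul_nonneg (h i).1.2.1 (h i).2.1.2.1)]
    exact (mul_le_of_le_one_left (h i).2.1.2.1 (h i).1.2.2).trans (h i).2.1.2.2
  unfold agentValue
  have hsub : ∀ i : Fin T, Integrable (fun h : History E T =>
      γ ^ ((i : ℕ) + 1) * (((h i).1 : ℝ) * ((h i).2.2 : ℝ) - c (h i).2.1)) (law M S F T) :=
    fun i => ((hiy i).sub (hicost i)).const_mul _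
  rw [integral_finsetSum _ fun i _ => hsub i]
  refine Finset.sum_congr rfl fun i _ => ?_
  rw [integral_const_mul]
  congr 1
  unfold roundPayoff payoff
  have h1 := integral_sub (hiy i) (hicost i)
  have h2 := integral_sub (hia i) (hicost i)
  have h3 := integral_round_mul_output M S F i (w := fun β _ => (β : ℝ))
    (by unfold Function.uncurry; fun_prop) (B := 1)
    (fun β _ => by rw [abs_of_nonneg β.2.1]; exact β.2.2)
  rw [h3] at h1
  exact h1.trans h2.symm

/-- The strategy that follows `S` in the first `t` rounds and plays myopically afterwards. -/
noncomputable def myopicAfter (hbr : IsBestResponse E c a) (S : Strategy E) (t : ℕ) :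
    Strategy E where
  act i := if i < t then S.act i else Kernel.deterministic
    (fun p : History E i × unitInterval => bestEffort hbr p.2)
    ((measurable_bestEffort hbr).comp measurable_snd)
  isMarkov i := by
    split_ifs
    · infer_instance
    · infer_instance

theorem law_myopicAfter (hbr : IsBestResponse E c a) {t i : ℕ} (hi : i ≤ t) :
    law M (myopicAfter hbr S t) F i = law M S F i := by
  induction i with
  | zero => rfl
  | succ i ih =>
    have : roundKernel M (myopicAfter hbr S t) F i = roundKernel M S F i := by
      unfold roundKernel
      simp only [myopicAfter, if_pos (show i < t by omega)]
    rw [law, law, ih (by omega), this]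

theorem roundPayoff_myopicAfter_of_lt (hc : MonotoneOn c (Set.Icc (0 : ℝ) E))
    (hbr : IsBestResponse E c a) {T t : ℕ} (i : Fin T) (hi : (i : ℕ) < t) :
    roundPayoff c M (myopicAfter hbr S t) F i = roundPayoff c M S F i := by
  have hm := measurable_payoff_round (E := E) hc
  have h1 := integral_law_last M (myopicAfter hbr S t) F i hm
  rw [law_myopicAfter M S F hbr (show (i : ℕ) + 1 ≤ t by omega),
    ← integral_law_last M S F i hm] at h1
  exact h1

theorem roundPayoff_myopicAfter_of_ge (hbr : IsBestResponse E c a) {T t : ℕ} (i : Fin T)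
    (hi : t ≤ (i : ℕ)) :
    roundPayoff c M (myopicAfter hbr S t) F i =
      ∫ h, payoff c (h i).1 (bestEffort hbr (h i).1) ∂law M (myopicAfter hbr S t) F T := by
  have hms : MeasurableSet {p : unitInterval × Effort E × unitInterval |
      p.2.1 = bestEffort hbr p.1} :=
    measurableSet_eq_fun (by fun_prop) ((measurable_bestEffort hbr).comp measurable_fst)
  have := ae_law_round M (myopicAfter hbr S t) F i hms (fun h => by
    rw [ae_iff]
    change roundKernel M (myopicAfter hbr S t) F i h {p | p.2.1 = bestEffort hbr p.1}ᶜ = 0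
    rw [← lintegral_indicator_one hms.compl,
      lintegral_roundKernel _ _ _ _ (measurable_one.indicator hms.compl)]
    simp [myopicAfter, if_neg (not_lt.2 hi), Kernel.deterministic_apply, Set.indicator,
      lintegral_dirac])
  refine integral_congr_ae ?_
  filter_upwards [this] with h hh
  rw [hh]

variable {K : ℕ} (C : Fin K → unitInterval) (D : ℕ) (δ : ℝ)

/-- The contracts of the rounds `t, …, t + D + 1` are determined by the first `t` rounds. -/
theorem integral_payoff_best_eq (hc : MonotoneOn c (Set.Icc (0 : ℝ) E))
    (hbr : IsBestResponse E c a) {T T' t : ℕ} (i : Fin T) (hti : t ≤ (i : ℕ))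
    (hi : (i : ℕ) ≤ t + D + 1) :
    ∫ h, payoff c (h i).1 (bestEffort hbr (h i).1)
        ∂law (delayedElimination C T' D δ) S F T =
      ∫ h, (fun β => payoff c β (bestEffort hbr β))
        (posted C i (stage C T' D δ (publicPart h) i))
          ∂law (delayedElimination C T' D δ) S F t := by
  have htT : t ≤ T := by omega
  have hstage : Measurable fun h : History E t =>
      posted C i (stage C T' D δ (publicPart h) i) := by
    intro U _
    have : (fun h : History E t => posted C i (stage C T' D δ (publicPart h) i)) ⁻¹' U =
        publicPart ⁻¹' (⋃ s : Finset (Fin K) × ℕ,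
          {h | stage C T' D δ h i = s} ∩ {_h | posted C i s ∈ U}) := by
      ext h
      simp
    rw [this]
    exact measurable_publicPart (MeasurableSet.iUnion fun s =>
      (measurableSet_stage_eq C T' D δ i s).inter (measurableSet_prop _))
  have hcomp : Measurable fun h : History E t => (fun β => payoff c β (bestEffort hbr β))
      (posted C i (stage C T' D δ (publicPart h) i)) :=
    (measurable_payoff_best hc hbr).comp hstage
  rw [← law_map_firstRounds _ S F htT, integral_map (measurable_firstRounds _).aemeasurable
    hcomp.aestronglyMeasurable]
  refine integral_congr_ae ?_
  filter_upwards [ae_posted C T' D δ S F T] with h hh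
  have : stage C T' D δ (publicPart h) i =
      stage C T' D δ (publicPart (firstRounds htT h)) i :=
    stage_castLE C T' D δ htT (publicPart h) i hi
  rw [← this, ← hh i]

/-- Against delayed elimination, the expected myopic loss of an optimal strategy in any round is
at most `T γ ^ D`. -/
theorem expected_loss_le (hc : MonotoneOn c (Set.Icc (0 : ℝ) E)) (hc0 : c 0 = 0) (hE : 0 ≤ E)
    (hE1 : E ≤ 1) (hbr : IsBestResponse E c a) {γ : ℝ} (hγ0 : 0 < γ) (hγ1 : γ < 1) {T T' : ℕ}
    (hS : IsOptimalStrategy c γ T F (delayedElimination C T' D δ) S) (i : Fin T) :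
    ∫ h, (payoff c (h i).1 (bestEffort hbr (h i).1) - payoff c (h i).1 (h i).2.1)
      ∂law (delayedElimination C T' D δ) S F T ≤ T * γ ^ D := by
  set M := delayedElimination C T' D δ with hM
  set S' := myopicAfter hbr S i with hS'
  have hopt := hS S'
  rw [agentValue_eq_sum M S F hc hc0 hE, agentValue_eq_sum M S' F hc hc0 hE, ← sub_nonpos,
    ← Finset.sum_sub_distrib] at hopt
  set loss := ∫ h, (payoff c (h i).1 (bestEffort hbr (h i).1) - payoff c (h i).1 (h i).2.1)
      ∂law M S F T with hloss
  -- Both strategies have the same law up to round `i`, which already fixes the contracts of these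
  -- rounds; the myopic payoffs therefore have equal expectations.
  have hlow : ∀ j : Fin T, i ≤ j → (j : ℕ) ≤ i + D + 1 →
      roundPayoff c M S' F j - roundPayoff c M S F j =
        ∫ h, (payoff c (h j).1 (bestEffort hbr (h j).1) - payoff c (h j).1 (h j).2.1)
          ∂law M S F T := by
    intro j hij hj
    rw [integral_sub (integrable_payoff_best M S F hc hc0 hE hbr j)
      (integrable_payoff M S F hc hc0 hE j), roundPayoff_myopicAfter_of_ge M S F hbr j hij,
      integral_payoff_best_eq S' F C D δ hc hbr j hij hj,
      integral_payoff_best_eq S F C D δ hc hbr j hij hj, law_myopicAfter _ S F hbr le_rfl]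
    rfl
  have hterm : ∀ j : Fin T, (if j = i then γ ^ ((i : ℕ) + 1) * loss else 0) -
      γ ^ ((i : ℕ) + 1 + D) ≤ γ ^ ((j : ℕ) + 1) * roundPayoff c M S' F j -
        γ ^ ((j : ℕ) + 1) * roundPayoff c M S F j := by
    intro j
    rw [← mul_sub]
    have hpos : 0 < γ ^ ((i : ℕ) + 1 + D) := by positivity
    rcases lt_or_ge j i with hji | hij
    · rw [if_neg hji.ne, roundPayoff_myopicAfter_of_lt M S F hc hbr j hji]
      simp [hpos.le]
    -- Beyond the delay the contracts may differ: myopic play still earns at least `0` (zero effort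
    -- is free), and `S` earns at most `1`.
    rcases Nat.lt_or_ge (i + D + 1) j with hj | hj
    · have hne : j ≠ i := by rintro rfl; omega
      rw [if_neg hne]
      have h1 : 0 ≤ roundPayoff c M S' F j := by
        rw [roundPayoff_myopicAfter_of_ge M S F hbr j hij]
        exact integral_nonneg fun h => payoff_best_nonneg hc0 hE hbr _
      have h2 : roundPayoff c M S F j ≤ 1 := by
        calc roundPayoff c M S F j ≤ ∫ _h, (1 : ℝ) ∂law M S F T := by
              refine integral_mono (integrable_payoff M S F hc hc0 hE j)
                (integrable_const 1) fun h => ?_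
              have e1 := cost_nonneg hc hc0 hE (h j).2.1
              have e2 : ((h j).1 : ℝ) * (h j).2.1 ≤ 1 :=
                mul_le_one₀ (h j).1.2.2 (h j).2.1.2.1 ((h j).2.1.2.2.trans hE1)
              simp only [payoff]
              linarith
          _ = 1 := by simp
      have h3 : γ ^ ((j : ℕ) + 1) ≤ γ ^ ((i : ℕ) + 1 + D) :=
        pow_le_pow_of_le_one hγ0.le hγ1.le (by omega)
      have h4 : 0 < γ ^ ((j : ℕ) + 1) := by positivity
      nlinarith
    · rw [hlow j hij hj]
      by_cases hji : j = i
      · subst hji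
        rw [if_pos rfl]
        linarith
      · rw [if_neg hji]
        have : 0 ≤ ∫ h, (payoff c (h j).1 (bestEffort hbr (h j).1) -
            payoff c (h j).1 (h j).2.1) ∂law M S F T :=
          integral_nonneg fun h => sub_nonneg.2 (payoff_le_best hbr _ _)
        have h4 : 0 < γ ^ ((j : ℕ) + 1) := by positivity
        have := mul_nonneg h4.le this
        linarith
  have hsum := (Finset.sum_le_sum fun j (_ : j ∈ Finset.univ) => hterm j).trans hopt
  rw [Finset.sum_sub_distrib, Finset.sum_ite_eq' Finset.univ i, if_pos (Finset.mem_univ i),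
    Finset.sum_const, Finset.card_univ, Fintype.card_fin, nsmul_eq_mul, pow_add _ ((i : ℕ) + 1)] at hsum
  have hpos : 0 < γ ^ ((i : ℕ) + 1) := by positivity
  by_contra hcon
  push Not at hcon
  nlinarith

/-- Against delayed elimination, the efforts of an optimal strategy are close to the myopic
ones. -/
theorem expected_sq_deviation_le (hc : MonotoneOn c (Set.Icc (0 : ℝ) E)) (hc0 : c 0 = 0)
    (hE : 0 ≤ E) (hE1 : E ≤ 1) (hbr : IsBestResponse E c a) {lam : ℝ} (hlam : 0 < lam)
    (hsc : StrongConvexOn (Set.Icc (0 : ℝ) E) lam c) {γ : ℝ} (hγ0 : 0 < γ) (hγ1 : γ < 1)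
    {T T' : ℕ} (hS : IsOptimalStrategy c γ T F (delayedElimination C T' D δ) S) (i : Fin T) :
    ∫ h, (((h i).2.1 : ℝ) - bestEffort hbr (h i).1) ^ 2
      ∂law (delayedElimination C T' D δ) S F T ≤ 4 / lam * (T * γ ^ D) := by
  have h1 := expected_loss_le S F C D δ hc hc0 hE hE1 hbr hγ0 hγ1 hS i
  have hi : Measurable fun h : History E T => (h i).1 := (measurable_pi_apply i).fst
  have hb := (measurable_bestEffort hbr).comp hi
  have hint : Integrable (fun h : History E T =>
      (((h i).2.1 : ℝ) - bestEffort hbr (h i).1) ^ 2)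
      (law (delayedElimination C T' D δ) S F T) := by
    refine Integrable.of_bound (Measurable.aestronglyMeasurable ?_) 1
      (Eventually.of_forall fun h => ?_)
    · have : Measurable fun h : History E T => ((bestEffort hbr (h i).1 : Effort E) : ℝ) :=
        measurable_subtype_coe.comp hb
      have h' : Measurable fun h : History E T => ((h i).2.1 : ℝ) := by fun_prop
      exact (h'.sub this).pow_const 2
    · rw [Real.norm_eq_abs, abs_of_nonneg (sq_nonneg _)]
      have e1 := (h i).2.1.2
      have e2 := (bestEffort hbr (h i).1).2
      rw [sq_le_one_iff_abs_le_one, abs_le]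
      constructor <;> linarith [e1.1, e1.2, e2.1, e2.2]
  have h2 : lam / 4 * ∫ h, (((h i).2.1 : ℝ) - bestEffort hbr (h i).1) ^ 2
      ∂law (delayedElimination C T' D δ) S F T ≤ T * γ ^ D := by
    rw [← integral_const_mul]
    refine le_trans (integral_mono (hint.const_mul _)
      ((integrable_payoff_best _ S F hc hc0 hE hbr i).sub
        (integrable_payoff _ S F hc hc0 hE i)) fun h => ?_) h1
    exact quadratic_le_loss hbr hsc (h i).1.2 (h i).2.1.2
  rw [div_mul_eq_mul_div, le_div_iff₀ hlam]
  linarith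

end Incentive

/-! ### Quadratic behaviour of the utility at its maximizer -/

section Utility

/-- Second-order expansion at a critical point. -/
theorem exists_second_order_expansion {u : ℝ → ℝ} {x₀ d ε : ℝ} (hε : 0 < ε)
    (hdiff : ∀ᶠ x in 𝓝 x₀, DifferentiableAt ℝ u x) (hd : HasDerivAt (deriv u) d x₀)
    (h0 : deriv u x₀ = 0) :
    ∃ r > 0, ∀ x, |x - x₀| < r → |u x - u x₀ - d / 2 * (x - x₀) ^ 2| ≤ ε * (x - x₀) ^ 2 := by
  have hlo := hasDerivAt_iff_isLittleO.1 hd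
  have hev := (hlo.bound hε).and hdiff
  obtain ⟨r, hr, hball⟩ := Metric.eventually_nhds_iff.1 hev
  refine ⟨r, hr, fun x hx => ?_⟩
  have hin : ∀ y ∈ Metric.closedBall x₀ |x - x₀|, DifferentiableAt ℝ u y ∧
      |deriv u y - d * (y - x₀)| ≤ ε * |x - x₀| := by
    intro y hy
    rw [Metric.mem_closedBall, Real.dist_eq] at hy
    obtain ⟨h1, h2⟩ := hball (y := y) (by rw [Real.dist_eq]; linarith)
    refine ⟨h2, ?_⟩
    rw [h0, Real.norm_eq_abs, Real.norm_eq_abs, smul_eq_mul, sub_zero, mul_comm (y - x₀)] at h1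
    exact h1.trans (by gcongr)
  have hder : ∀ y ∈ Metric.closedBall x₀ |x - x₀|,
      HasDerivAt (fun y => u y - d / 2 * (y - x₀) ^ 2) (deriv u y - d * (y - x₀)) y := by
    intro y hy
    have h1 := (hin y hy).1.hasDerivAt
    have h2 := (((hasDerivAt_id y).sub_const x₀).pow 2).const_mul (d / 2)
    refine (h1.sub h2).congr_deriv ?_
    simp
    ring
  -- Mean value inequality for `u` minus its quadratic model on the ball of radius `|x - x₀|`, where
  -- the derivative is at most `ε * |x - x₀|`.
  have hmv := Convex.norm_image_sub_le_of_norm_deriv_le (C := ε * |x - x₀|)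
    (fun y hy => (hder y hy).differentiableAt)
    (fun y hy => by rw [(hder y hy).deriv]; exact (hin y hy).2)
    (convex_closedBall x₀ |x - x₀|) (Metric.mem_closedBall_self (abs_nonneg _))
    (show x ∈ Metric.closedBall x₀ |x - x₀| by rw [Metric.mem_closedBall, Real.dist_eq])
  rw [Real.norm_eq_abs, Real.norm_eq_abs, mul_assoc, ← sq, sq_abs] at hmv
  convert hmv using 2
  simp
  ring

variable {E : ℝ} {c a : ℝ → ℝ}

theorem continuousOn_truthfulUtility {lam : ℝ} (hlam : 0 < lam) (hbr : IsBestResponse E c a)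
    (hsc : StrongConvexOn (Set.Icc (0 : ℝ) E) lam c) :
    ContinuousOn (truthfulUtility a) (Set.Icc (0 : ℝ) 1) := by
  have : LipschitzOnWith (Real.toNNReal (2 / lam)) a (Set.Icc (0 : ℝ) 1) := by
    refine LipschitzOnWith.of_dist_le_mul fun x hx y hy => ?_
    rw [Real.dist_eq, Real.dist_eq, Real.coe_toNNReal _ (by positivity)]
    exact lipschitz_bestResponse hlam hbr hsc hx hy
  unfold truthfulUtility
  exact (by fun_prop : ContinuousOn (fun β : ℝ => 1 - β) _).mul this.continuousOn

theorem truthfulUtility_nonneg (hbr : IsBestResponse E c a) {β : ℝ}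
    (hβ : β ∈ Set.Icc (0 : ℝ) 1) : 0 ≤ truthfulUtility a β :=
  mul_nonneg (by linarith [hβ.2]) (hbr β hβ).1.1

theorem truthfulUtility_le (hbr : IsBestResponse E c a) {β : ℝ}
    (hβ : β ∈ Set.Icc (0 : ℝ) 1) : truthfulUtility a β ≤ E :=
  (mul_le_of_le_one_left (hbr β hβ).1.1 (by linarith [hβ.1])).trans (hbr β hβ).1.2

/-- A unique maximizer of the truthful utility lies in the interior. -/
theorem maximizer_mem_Ioo (hE : 0 ≤ E) (hc : MonotoneOn c (Set.Icc (0 : ℝ) E)) {lam : ℝ}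
    (hlam : 0 < lam) (hbr : IsBestResponse E c a)
    (hsc : StrongConvexOn (Set.Icc (0 : ℝ) E) lam c) {βs : ℝ} (hβs : βs ∈ Set.Icc (0 : ℝ) 1)
    (hmax : ∀ β ∈ Set.Icc (0 : ℝ) 1, β ≠ βs → truthfulUtility a β < truthfulUtility a βs) :
    βs ∈ Set.Ioo (0 : ℝ) 1 := by
  have h1 : truthfulUtility a 1 = 0 := by simp [truthfulUtility]
  refine ⟨lt_of_le_of_ne hβs.1 ?_, lt_of_le_of_ne hβs.2 ?_⟩
  -- At contract `0` effort earns nothing, so strong convexity and monotone cost force `a 0 = 0`;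
  -- then `u 0 = 0 = u 1` contradicts uniqueness.
  · rintro rfl
    have h0 := hmax 1 ⟨zero_le_one, le_rfl⟩ one_ne_zero
    have h2 := quadratic_le_loss hbr hsc (β := 0) (by simp) (x := 0) ⟨le_rfl, hE⟩
    have h3 := hc ⟨le_rfl, hE⟩ (hbr 0 (by simp)).1 (hbr 0 (by simp)).1.1
    rw [h1] at h0
    simp only [truthfulUtility, sub_zero, one_mul] at h0
    have : 0 < lam / 4 * (0 - a 0) ^ 2 := by
      have : 0 - a 0 ≠ 0 := by linarith
      positivity
    linarith
  · rintro rfl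
    have h0 := hmax 0 ⟨le_rfl, zero_le_one⟩ zero_ne_one
    have := truthfulUtility_nonneg hbr (β := 0) (by simp)
    linarith

/-- The gap to a nondegenerate unique maximizer is comparable with the squared distance. -/
theorem exists_quadratic_gap (hE : 0 ≤ E) (hc : MonotoneOn c (Set.Icc (0 : ℝ) E)) {lam : ℝ}
    (hlam : 0 < lam) (hbr : IsBestResponse E c a)
    (hsc : StrongConvexOn (Set.Icc (0 : ℝ) E) lam c) {βs : ℝ} (hβs : βs ∈ Set.Icc (0 : ℝ) 1)
    (hmax : ∀ β ∈ Set.Icc (0 : ℝ) 1, β ≠ βs → truthfulUtility a β < truthfulUtility a βs)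
    (hdiff : ∀ᶠ β in 𝓝 βs, DifferentiableAt ℝ (truthfulUtility a) β) {d : ℝ} (hd0 : d ≠ 0)
    (hd : HasDerivAt (deriv (truthfulUtility a)) d βs) :
    ∃ c₀ > 0, ∃ C₀ > 0, ∀ β ∈ Set.Icc (0 : ℝ) 1,
      c₀ * (β - βs) ^ 2 ≤ truthfulUtility a βs - truthfulUtility a β ∧
      truthfulUtility a βs - truthfulUtility a β ≤ C₀ * (β - βs) ^ 2 := by
  set u := truthfulUtility a with hu
  have hIoo := maximizer_mem_Ioo hE hc hlam hbr hsc hβs hmax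
  have hmax' : ∀ β ∈ Set.Icc (0 : ℝ) 1, u β ≤ u βs := fun β hβ => by
    by_cases h : β = βs
    · rw [h]
    · exact (hmax β hβ h).le
  have hcrit : deriv u βs = 0 := by
    refine IsLocalMax.deriv_eq_zero ?_
    filter_upwards [Icc_mem_nhds hIoo.1 hIoo.2] with β hβ using hmax' β hβ
  have hdabs : 0 < |d| := abs_pos.2 hd0
  obtain ⟨r, hr, hexp⟩ := exists_second_order_expansion (ε := |d| / 4) (by positivity)
    hdiff hd hcrit
  -- If `d > 0`, then a point slightly to the right of `βs` would have at least the same utility,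
  -- because the error `|d| / 4` is below `d / 2`.
  have hdneg : d < 0 := by
    by_contra hcon
    push Not at hcon
    set x := βs + min r (1 - βs) / 2 with hx
    have hmin : 0 < min r (1 - βs) := lt_min hr (by linarith [hIoo.2])
    have hx1 : x ∈ Set.Icc (0 : ℝ) 1 :=
      ⟨by linarith [hIoo.1], by linarith [min_le_right r (1 - βs)]⟩
    have hx2 := hmax x hx1 (by linarith)
    have hxr : |x - βs| < r := by
      rw [hx, add_sub_cancel_left, abs_of_pos (by positivity)]
      linarith [min_le_left r (1 - βs)]
    have h1 := (abs_le.1 (hexp x hxr)).1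
    rw [abs_of_nonneg hcon] at h1
    have : 0 ≤ d * (x - βs) ^ 2 := by positivity
    linarith
  have hlocal : ∀ x, |x - βs| < r → |d| / 4 * (x - βs) ^ 2 ≤ u βs - u x ∧
      u βs - u x ≤ 3 * |d| / 4 * (x - βs) ^ 2 := by
    intro x hx
    have h1 := abs_le.1 (hexp x hx)
    rw [abs_of_neg hdneg] at h1 ⊢
    constructor <;> linarith [h1.1, h1.2]
  -- Away from `βs` the gap is bounded below by uniqueness, continuity and compactness.
  have hfar : ∃ m > 0, ∀ β ∈ Set.Icc (0 : ℝ) 1 \ Metric.ball βs r, m ≤ u βs - u β := by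
    rcases (Set.Icc (0 : ℝ) 1 \ Metric.ball βs r).eq_empty_or_nonempty with he | hne
    · exact ⟨1, one_pos, fun β hβ => by rw [he] at hβ; exact absurd hβ (Set.notMem_empty β)⟩
    · have hcont : ContinuousOn (fun β => u βs - u β) (Set.Icc (0 : ℝ) 1 \ Metric.ball βs r) :=
        continuousOn_const.sub ((continuousOn_truthfulUtility hlam hbr hsc).mono
          Set.sdiff_subset)
      obtain ⟨x, hx, hmin⟩ := (isCompact_Icc.diff Metric.isOpen_ball).exists_isMinOn hne hcont
      refine ⟨u βs - u x, sub_pos.2 (hmax x hx.1 ?_), fun β hβ => hmin hβ⟩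
      rintro rfl
      exact hx.2 (Metric.mem_ball_self hr)
  obtain ⟨m, hm, hfar⟩ := hfar
  -- Far from `βs`: the squared distance is at most `1`, so `m` serves below; it is at least `r ^ 2`
  -- and the gap is at most `E`, so `E / r ^ 2` serves above.
  refine ⟨min (|d| / 4) m, lt_min (by positivity) hm, 3 * |d| / 4 + E / r ^ 2, by positivity,
    fun β hβ => ?_⟩
  have hsq : 0 ≤ (β - βs) ^ 2 := sq_nonneg _
  rcases lt_or_ge |β - βs| r with h | h
  · obtain ⟨h1, h2⟩ := hlocal β h
    constructor
    · exact le_trans (by gcongr; exact min_le_left _ _) h1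
    · refine h2.trans ?_
      gcongr
      have : 0 ≤ E / r ^ 2 := by positivity
      linarith
  · constructor
    · refine le_trans ?_ (hfar β ⟨hβ, ?_⟩)
      · have : (β - βs) ^ 2 ≤ 1 := by
          rw [sq_le_one_iff_abs_le_one, abs_le]
          constructor <;> linarith [hβ.1, hβ.2, hβs.1, hβs.2]
        exact (mul_le_of_le_one_right (lt_min (by positivity) hm).le this).trans
          (min_le_right _ _)
      · rw [Metric.mem_ball, Real.dist_eq]
        exact not_lt.2 h
    · have h1 := truthfulUtility_le hbr hβs
      have h2 := truthfulUtility_nonneg hbr hβ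
      have h3 : r ^ 2 ≤ (β - βs) ^ 2 := by
        rw [← sq_abs (β - βs)]
        gcongr
      have h4 : E ≤ E / r ^ 2 * (β - βs) ^ 2 := by
        rw [div_mul_eq_mul_div, le_div_iff₀ (by positivity)]
        gcongr
      have h5 : 0 ≤ 3 * |d| / 4 * (β - βs) ^ 2 := by positivity
      rw [add_mul]
      change u βs ≤ E at h1
      change 0 ≤ u β at h2
      linarith

end Utility

/-! ### Sums of inverse squared distances on the grid -/

section Grid

theorem sum_inv_sq_le_two {ι : Type*} (s : Finset ι) {f : ι → ℝ} {p : ι → ℕ}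
    (hinj : Set.InjOn p s) (hpos : ∀ k ∈ s, 0 < p k)
    (hf : ∀ k ∈ s, f k ≤ ((p k : ℝ) ^ 2)⁻¹) : ∑ k ∈ s, f k ≤ 2 := by
  calc ∑ k ∈ s, f k ≤ ∑ k ∈ s, ((p k : ℝ) ^ 2)⁻¹ := Finset.sum_le_sum hf
    _ = ∑ j ∈ s.image p, ((j : ℝ) ^ 2)⁻¹ :=
      (Finset.sum_image (f := fun j : ℕ => ((j : ℝ) ^ 2)⁻¹) hinj).symm
    _ ≤ ∑ j ∈ Finset.Ioo 0 (s.sup p + 1), ((j : ℝ) ^ 2)⁻¹ := by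
      refine Finset.sum_le_sum_of_subset_of_nonneg (fun j hj => ?_) fun _ _ _ => by positivity
      obtain ⟨k, hk, rfl⟩ := Finset.mem_image.1 hj
      exact Finset.mem_Ioo.2 ⟨hpos k hk, Nat.lt_succ_of_le (Finset.le_sup hk)⟩
    _ ≤ 2 := by simpa using sum_Ioo_inv_sq_le (α := ℝ) 0 (s.sup p + 1)

/-- On each side of `z`, rounding the distance down to `k - ⌊z⌋` or `⌊z⌋ - k - 1` gives distinct
positive integers, so each side is at most `2`. Distance above `1` is what makes the left-hand
integers positive. -/
theorem sum_inv_sq_dist_le (K : ℕ) (z : ℝ) :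
    ∑ k ∈ Finset.univ.filter (fun k : Fin K => 1 < |((k : ℕ) : ℝ) + 1 - z|),
      ((((k : ℕ) : ℝ) + 1 - z) ^ 2)⁻¹ ≤ 4 := by
  have hfl := Int.floor_le z
  have hlf := Int.lt_floor_add_one z
  rw [← Finset.sum_filter_add_sum_filter_not _ (fun k : Fin K => z < ((k : ℕ) : ℝ) + 1)]
  have h1 := sum_inv_sq_le_two ((Finset.univ.filter
      (fun k : Fin K => 1 < |((k : ℕ) : ℝ) + 1 - z|)).filter (fun k : Fin K => z < ((k : ℕ) : ℝ) + 1))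
    (f := fun k => ((((k : ℕ) : ℝ) + 1 - z) ^ 2)⁻¹) (p := fun k => (((k : ℕ) : ℤ) - ⌊z⌋).toNat)
  have h2 := sum_inv_sq_le_two ((Finset.univ.filter
      (fun k : Fin K => 1 < |((k : ℕ) : ℝ) + 1 - z|)).filter (fun k : Fin K => ¬ z < ((k : ℕ) : ℝ) + 1))
    (f := fun k => ((((k : ℕ) : ℝ) + 1 - z) ^ 2)⁻¹)
    (p := fun k => (⌊z⌋ - ((k : ℕ) : ℤ) - 1).toNat)
  have hr : ∀ k ∈ (Finset.univ.filter
      (fun k : Fin K => 1 < |((k : ℕ) : ℝ) + 1 - z|)).filter (fun k : Fin K => z < ((k : ℕ) : ℝ) + 1),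
      ⌊z⌋ < ((k : ℕ) : ℤ) := by
    intro k hk
    simp only [Finset.mem_filter, Finset.mem_univ, true_and] at hk
    rw [abs_of_pos (by linarith [hk.2])] at hk
    rw [Int.floor_lt]
    push_cast
    linarith [hk.1]
  have hl : ∀ k ∈ (Finset.univ.filter
      (fun k : Fin K => 1 < |((k : ℕ) : ℝ) + 1 - z|)).filter (fun k : Fin K => ¬ z < ((k : ℕ) : ℝ) + 1),
      ((k : ℕ) : ℤ) + 2 ≤ ⌊z⌋ := by
    intro k hk
    simp only [Finset.mem_filter, Finset.mem_univ, true_and, not_lt] at hk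
    rw [abs_of_nonpos (by linarith [hk.2])] at hk
    rw [Int.le_floor]
    push_cast
    linarith [hk.1]
  have h1' := h1 (fun k hk k' hk' he => by
      have e1 := hr k hk
      have e2 := hr k' hk'
      simp only at he
      exact Fin.ext (by omega)) (fun k hk => by
      have e1 := hr k hk
      omega) (fun k hk => by
      have e1 := hr k hk
      have e2 : (((((k : ℕ) : ℤ) - ⌊z⌋).toNat : ℕ) : ℝ) = ((k : ℕ) : ℝ) - ⌊z⌋ := by
        have : (((((k : ℕ) : ℤ) - ⌊z⌋).toNat : ℕ) : ℤ) = ((k : ℕ) : ℤ) - ⌊z⌋ :=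
          Int.toNat_of_nonneg (by omega)
        exact_mod_cast this
      have e3 : (⌊z⌋ : ℝ) < ((k : ℕ) : ℝ) := by exact_mod_cast e1
      rw [e2]
      have : 0 < ((k : ℕ) : ℝ) - ⌊z⌋ := by linarith
      exact inv_anti₀ (by positivity) (pow_le_pow_left₀ this.le (by linarith) 2))
  have h2' := h2 (fun k hk k' hk' he => by
      have e1 := hl k hk
      have e2 := hl k' hk'
      simp only at he
      exact Fin.ext (by omega)) (fun k hk => by
      have e1 := hl k hk
      omega) (fun k hk => by
      have e1 := hl k hk
      have e2 : ((((⌊z⌋ - ((k : ℕ) : ℤ) - 1).toNat : ℕ)) : ℝ) = ⌊z⌋ - ((k : ℕ) : ℝ) - 1 := by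
        have : (((⌊z⌋ - ((k : ℕ) : ℤ) - 1).toNat : ℕ) : ℤ) = ⌊z⌋ - ((k : ℕ) : ℤ) - 1 :=
          Int.toNat_of_nonneg (by omega)
        exact_mod_cast this
      have e3 : ((k : ℕ) : ℝ) + 2 ≤ ⌊z⌋ := by exact_mod_cast e1
      rw [e2, ← neg_sq (((k : ℕ) : ℝ) + 1 - z)]
      have : 0 < (⌊z⌋ : ℝ) - ((k : ℕ) : ℝ) - 1 := by linarith
      exact inv_anti₀ (by positivity) (pow_le_pow_left₀ this.le (by linarith) 2))
  linarith

theorem grid_val {K : ℕ} (k : Fin K) : (grid K k : ℝ) = (((k : ℕ) : ℝ) + 1) / K := by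
  have hK : (0 : ℝ) < K := by exact_mod_cast (Fin.pos k)
  have hk : ((k : ℕ) : ℝ) + 1 ≤ K := by exact_mod_cast k.2
  unfold grid
  rw [Set.projIcc_of_mem zero_le_one (x := (((k : ℕ) : ℝ) + 1) / K)
    ⟨by positivity, by rw [div_le_one hK]; exact hk⟩]

theorem grid_injective (K : ℕ) : Function.Injective (grid K) := by
  intro k k' h
  have hK : (0 : ℝ) < K := by exact_mod_cast (Fin.pos k)
  have := congrArg (fun x : unitInterval => (x : ℝ)) h
  simp only [grid_val] at this
  rw [div_left_inj' hK.ne'] at this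
  exact Fin.ext (by exact_mod_cast add_right_cancel this)

theorem exists_grid_near {K : ℕ} (hK : 0 < K) {β : ℝ} (hβ : β ∈ Set.Icc (0 : ℝ) 1) :
    ∃ k : Fin K, |(grid K k : ℝ) - β| ≤ 1 / K := by
  have hK' : (0 : ℝ) < K := by exact_mod_cast hK
  have hc0 := Nat.le_ceil (K * β)
  have hc1 := Nat.ceil_lt_add_one (mul_nonneg hK'.le hβ.1)
  have hcK : ⌈K * β⌉₊ ≤ K := Nat.ceil_le.2 (mul_le_of_le_one_right hK'.le hβ.2)
  refine ⟨⟨⌈K * β⌉₊ - 1, by omega⟩, ?_⟩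
  have h1 : ((⌈K * β⌉₊ - 1 : ℕ) : ℝ) + 1 - K * β ≤ 1 ∧
      0 ≤ ((⌈K * β⌉₊ - 1 : ℕ) : ℝ) + 1 - K * β := by
    -- For `β = 0` the subtraction truncates, and the first grid point `1 / K` is used.
    rcases Nat.eq_zero_or_pos ⌈K * β⌉₊ with h0 | h0
    · rw [h0] at hc0 ⊢
      have := mul_nonneg hK'.le hβ.1
      norm_num at hc0 ⊢
      constructor <;> linarith
    · rw [Nat.cast_sub h0]
      push_cast
      constructor <;> linarith
  have h2 : (((⌈K * β⌉₊ - 1 : ℕ) : ℝ) + 1) / K - β =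
      (((⌈K * β⌉₊ - 1 : ℕ) : ℝ) + 1 - K * β) / K := by field_simp
  rw [grid_val]
  simp only
  rw [h2, abs_of_nonneg (div_nonneg h1.2 hK'.le)]
  gcongr
  exact h1.1

end Grid

/-! ### From accurate paths to expected regret -/

section Regret

variable {E : ℝ} {c a : ℝ → ℝ} {K T D : ℕ}

theorem one_le_log {T : ℕ} (hT : 3 ≤ T) : 1 ≤ Real.log T := by
  rw [Real.le_log_iff_exp_le (by positivity)]
  have : (3 : ℝ) ≤ T := by exact_mod_cast hT
  linarith [Real.exp_one_lt_d9]

/-- Total gap along an accurate path of delayed elimination on the grid. -/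
theorem sum_gap_grid_le (hT : 3 ≤ T) (hK : 0 < K) (hKT : (K : ℝ) ^ 2 ≤ 4 * T) {βs c₀ C₀ : ℝ}
    (hβs : βs ∈ Set.Icc (0 : ℝ) 1) (hc₀ : 0 < c₀) (hC₀ : 32 ≤ C₀)
    (hgap : ∀ β ∈ Set.Icc (0 : ℝ) 1,
      c₀ * (β - βs) ^ 2 ≤ truthfulUtility a βs - truthfulUtility a β ∧
      truthfulUtility a βs - truthfulUtility a β ≤ C₀ * (β - βs) ^ 2)
    (hone : ∀ β ∈ Set.Icc (0 : ℝ) 1, truthfulUtility a βs - truthfulUtility a β ≤ 1)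
    {h : PublicHistory T}
    (hacc : Accurate (grid K) T D (1 / T) (fun k => truthfulUtility a (grid K k)) h)
    (hp : ∀ i : Fin T, (h i).1 = posted (grid K) i (stage (grid K) T D (1 / T) h i)) :
    ∑ i, (truthfulUtility a βs - truthfulUtility a (h i).1) ≤
      T * (2 * C₀ / K ^ 2) + 8196 / c₀ * (Real.log T * K ^ 2) +
        2 * ((D + 1 + 2 * K : ℕ) : ℝ) := by
  have hlog := one_le_log hT
  have hK' : (0 : ℝ) < K := by exact_mod_cast hK
  have hT' : (0 : ℝ) < T := by positivity
  set u : Fin K → ℝ := fun k => truthfulUtility a (grid K k) with hu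
  set g : Fin K → ℝ := fun k => truthfulUtility a βs - u k with hg
  set x : ℝ := 2 * C₀ / K ^ 2 with hx
  have hx0 : 0 < x := by positivity
  have : Nonempty (Fin K) := ⟨⟨0, hK⟩⟩
  obtain ⟨ks, hks⟩ := Finite.exists_max u
  have hksx : g ks ≤ x / 2 := by
    obtain ⟨k, hk⟩ := exists_grid_near hK hβs
    have h1 := hks k
    have h2 := (hgap (grid K k) (grid K k).2).2
    have h3 : ((grid K k : ℝ) - βs) ^ 2 ≤ (1 / K) ^ 2 := by
      rw [← sq_abs]
      gcongr
    calc g ks ≤ g k := by simp only [hg]; linarith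
      _ ≤ C₀ * ((grid K k : ℝ) - βs) ^ 2 := h2
      _ ≤ C₀ * (1 / K) ^ 2 := by gcongr
      _ = x / 2 := by rw [hx]; field_simp
  have hl : ∀ k, ∃ l : ℕ, x < g k → (2⁻¹ : ℝ) ^ (l + 1) < g k ∧ g k ≤ 2⁻¹ ^ l := by
    intro k
    by_cases hk : x < g k
    · obtain ⟨l, hl⟩ := exists_nat_pow_near_of_lt_one (hx0.trans hk)
        (hone _ (grid K k).2) (y := (2⁻¹ : ℝ)) (by norm_num) (by norm_num)
      exact ⟨l, fun _ => hl⟩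
    · exact ⟨0, fun h' => absurd h' hk⟩
  choose l hl using hl
  -- `2048 = 2 * 16 ^ 2 * 4` makes the statistical radius at most `2⁻¹ ^ (j + 1) / 16`.
  set q : ℕ → ℕ := fun j => ⌈2048 * Real.log T * 4 ^ j⌉₊ with hq
  have hq0 : ∀ j, 0 < q j := fun j => Nat.ceil_pos.2 (by positivity)
  have hqx : ∀ j, 4 * (Real.sqrt (2 * Real.log T / q j) + 1 / T) ≤
      max (2⁻¹ ^ (j + 1)) x / 2 := by
    intro j
    have h1 : Real.sqrt (2 * Real.log T / q j) ≤ (2⁻¹ : ℝ) ^ (j + 1) / 16 := by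
      rw [Real.sqrt_le_left (by positivity)]
      have hqj : 2048 * Real.log T * 4 ^ j ≤ (q j : ℝ) := Nat.le_ceil _
      have hqp : (0 : ℝ) < q j := by exact_mod_cast hq0 j
      rw [div_le_iff₀ hqp]
      have e1 : ((2⁻¹ : ℝ) ^ (j + 1) / 16) ^ 2 * (2048 * Real.log T * 4 ^ j) =
          2 * Real.log T := by
        have : (4 : ℝ) ^ j = 2 ^ j * 2 ^ j := by rw [← mul_pow]; norm_num
        rw [this, inv_pow]
        field_simp
        ring
      rw [← e1]
      gcongr
    -- The perturbation is below the discretization error: `8 * K ^ 2 ≤ 32 * T ≤ C₀ * T`.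
    have h2 : 1 / (T : ℝ) ≤ x / 16 := by
      rw [hx, div_div, div_le_div_iff₀ hT' (by positivity)]
      nlinarith
    have h3 := le_max_left ((2⁻¹ : ℝ) ^ (j + 1)) x
    have h4 := le_max_right ((2⁻¹ : ℝ) ^ (j + 1)) x
    linarith
  have hA : ∀ m, (stage (grid K) T D (1 / T) h m).1.Nonempty :=
    fun m => ⟨ks, best_active hacc hks m⟩
  have hκ : ∀ i, ∃ k, (h i).1 = grid K k := fun i => by
    obtain ⟨k, -, hk, -⟩ := posted_min_plays (grid_injective K) hA hp i
    exact ⟨k, hk⟩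
  choose κ hκ using hκ
  have hmain := sum_gap_le (grid_injective K) (by omega) hacc hp (g := g)
    (U := truthfulUtility a βs) (fun _ => rfl) hx0.le hks hksx hl hq0 hqx κ hκ
  have hearly : ∑ k ∈ Finset.univ.filter (fun k => x < g k), g k * (q (l k) : ℝ) ≤
      8196 / c₀ * (Real.log T * K ^ 2) := by
    set z := K * βs with hz
    have hdist : ∀ k : Fin K, ((grid K k : ℝ) - βs) ^ 2 =
        (((k : ℕ) : ℝ) + 1 - z) ^ 2 / K ^ 2 := by
      intro k
      rw [grid_val, hz]
      field_simp
    -- Since `g k ≤ 2⁻¹ ^ l k`, the cost `g k * q (l k)` is at most about `log T / g k`, and the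
    -- lower quadratic bound controls `1 / g k`. The constant `2049` absorbs the ceiling.
    calc _ ≤ ∑ k ∈ Finset.univ.filter (fun k => x < g k),
          2049 / c₀ * (Real.log T * K ^ 2) * ((((k : ℕ) : ℝ) + 1 - z) ^ 2)⁻¹ := by
          refine Finset.sum_le_sum fun k hk => ?_
          have hk' := (Finset.mem_filter.1 hk).2
          have hgk : 0 < g k := hx0.trans hk'
          obtain ⟨-, hl2⟩ := hl k hk'
          have h1 : (q (l k) : ℝ) ≤ 2049 * Real.log T * 4 ^ (l k) := by
            have e1 := (Nat.ceil_lt_add_one (a := 2048 * Real.log T * 4 ^ (l k))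
              (by positivity)).le
            have e2 : (1 : ℝ) ≤ 4 ^ (l k) := one_le_pow₀ (by norm_num)
            have e3 : 1 ≤ Real.log T * 4 ^ (l k) := one_le_mul_of_one_le_of_one_le hlog e2
            change (q (l k) : ℝ) ≤ _ at e1
            linarith
          have h2 : g k ^ 2 * 4 ^ (l k) ≤ 1 := by
            calc g k ^ 2 * 4 ^ (l k) ≤ (2⁻¹ ^ (l k)) ^ 2 * 4 ^ (l k) := by gcongr
              _ = 1 := by
                rw [← pow_mul, mul_comm (l k) 2, pow_mul, ← mul_pow]
                norm_num
          have h3 := (hgap (grid K k) (grid K k).2).1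
          have h5 := (hgap (grid K k) (grid K k).2).2
          rw [hdist] at h3 h5
          have h4 : 0 < (((k : ℕ) : ℝ) + 1 - z) ^ 2 := by
            by_contra hcon
            have h0 : (((k : ℕ) : ℝ) + 1 - z) ^ 2 = 0 :=
              le_antisymm (not_lt.1 hcon) (sq_nonneg _)
            rw [h0, zero_div, mul_zero] at h5
            exact absurd h5 (not_le.2 hgk)
          calc g k * (q (l k) : ℝ) ≤ g k * (2049 * Real.log T * 4 ^ (l k)) := by gcongr
            _ = 2049 * Real.log T * (g k ^ 2 * 4 ^ (l k)) * (g k)⁻¹ := by field_simp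
            _ ≤ 2049 * Real.log T * 1 * (g k)⁻¹ := by gcongr
            _ ≤ 2049 * Real.log T * 1 *
                (c₀ * ((((k : ℕ) : ℝ) + 1 - z) ^ 2 / K ^ 2))⁻¹ := by
              gcongr
            _ = _ := by field_simp
      _ ≤ ∑ k ∈ Finset.univ.filter (fun k : Fin K => 1 < |((k : ℕ) : ℝ) + 1 - z|),
          2049 / c₀ * (Real.log T * K ^ 2) * ((((k : ℕ) : ℝ) + 1 - z) ^ 2)⁻¹ := by
          refine Finset.sum_le_sum_of_subset_of_nonneg (fun k hk => ?_)
            fun _ _ _ => by positivity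
          have hk' := (Finset.mem_filter.1 hk).2
          refine Finset.mem_filter.2 ⟨Finset.mem_univ _, ?_⟩
          have h5 := (hgap (grid K k) (grid K k).2).2
          rw [hdist] at h5
          -- A gap above `x` means a squared rescaled distance above `2`, in particular a distance
          -- above `1`.
          have h6 : 2 * C₀ / K ^ 2 < C₀ * ((((k : ℕ) : ℝ) + 1 - z) ^ 2 / K ^ 2) :=
            lt_of_lt_of_le hk' h5
          rw [← mul_div_assoc, div_lt_div_iff_of_pos_right (by positivity), mul_comm] at h6
          have h7 := lt_of_mul_lt_mul_left h6 (by linarith)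
          rw [← one_lt_sq_iff_one_lt_abs]
          linarith
      _ ≤ 2049 / c₀ * (Real.log T * K ^ 2) * 4 := by
          rw [← Finset.mul_sum]
          gcongr
          exact sum_inv_sq_dist_le K z
      _ = _ := by ring
  have hsum : ∑ i, (truthfulUtility a βs - truthfulUtility a (h i).1) = ∑ i, g (κ i) := by
    refine Finset.sum_congr rfl fun i _ => ?_
    rw [hκ i]
  rw [hsum]
  linarith

theorem principalValue_eq_sum (M : Mechanism) (S : Strategy E) (F : Technology E) :
    principalValue T F M S =
      ∑ i : Fin T, ∫ h, (1 - ((h i).1 : ℝ)) * ((h i).2.1 : ℝ) ∂law M S F T := by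
  unfold principalValue
  rw [integral_finsetSum]
  · refine Finset.sum_congr rfl fun i _ => ?_
    exact integral_round_mul_output M S F i (w := fun β _ => 1 - (β : ℝ))
      (by unfold Function.uncurry; fun_prop) (B := 1)
      (fun β _ => by
        rw [abs_of_nonneg (by linarith [β.2.2])]
        linarith [β.2.1])
  · intro i _
    refine Integrable.of_bound (by fun_prop) 1 (Eventually.of_forall fun h => ?_)
    have e1 := (h i).1.2
    have e2 := (h i).2.2.2
    rw [Real.norm_eq_abs, abs_of_nonneg (mul_nonneg (by linarith [e1.2]) e2.1)]
    exact mul_le_one₀ (by linarith [e1.1]) e2.1 e2.2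

/-- The effort `E` is the mean of an output in `[0,1]`. -/
theorem effort_le_one (F : Technology E) (hE : 0 ≤ E) : E ≤ 1 := by
  have h1 := F.mean_output ⟨E, hE, le_rfl⟩
  have h2 : ∫ y, (y : ℝ) ∂(F.output ⟨E, hE, le_rfl⟩) ≤
      ∫ _y, (1 : ℝ) ∂(F.output ⟨E, hE, le_rfl⟩) := by
    refine integral_mono ?_ (integrable_const 1) fun y => y.2.2
    refine Integrable.of_bound (by fun_prop) 1 (Eventually.of_forall fun y => ?_)
    rw [Real.norm_eq_abs, abs_of_nonneg y.2.1]
    exact y.2.2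
  simpa [h1] using h2

/-- Probability that delayed elimination meets a wrong confidence interval or an effort that is
not close to the myopic one. -/
theorem measure_bad_le (hT : 3 ≤ T) (hKT : (K : ℝ) ^ 2 ≤ 4 * T) (M : Mechanism)
    (S : Strategy E) (F : Technology E) (hE1 : E ≤ 1) (hbr : IsBestResponse E c a)
    (C : Fin K → unitInterval)
    (hsq : ∀ i : Fin T, ∫ h, (((h i).2.1 : ℝ) - bestEffort hbr (h i).1) ^ 2
      ∂law M S F T ≤ 4 / (T : ℝ) ^ 5) :
    (T : ℝ) * (law M S F T).real (deviationEvent E C T ∪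
      ⋃ i : Fin T, {h | 1 / (T : ℝ) < |((h i).2.1 : ℝ) - bestEffort hbr (h i).1|}) ≤ 20 := by
  have hT3 : (3 : ℝ) ≤ T := by exact_mod_cast hT
  have hT0 : (0 : ℝ) < T := by positivity
  have hdev : (law M S F T).real (deviationEvent E C T) ≤
      ((T + 1) * (K * ((T + 1) * 2))) * ((T : ℝ) ^ 4)⁻¹ := by
    have h1 := measure_deviationEvent_le M S F C T
    have h2 : Real.exp (-(4 * Real.log T)) = ((T : ℝ) ^ 4)⁻¹ := by
      rw [Real.exp_neg, mul_comm, Real.exp_mul, Real.exp_log hT0]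
      norm_cast
    rw [h2] at h1
    have h3 := ENNReal.toReal_mono (by finiteness) h1
    refine h3.trans (le_of_eq ?_)
    rw [ENNReal.toReal_mul, ENNReal.toReal_ofReal (by positivity)]
    simp only [ENNReal.toReal_mul, ENNReal.toReal_natCast, ENNReal.toReal_ofNat]
    have : ((T : ℝ≥0∞) + 1).toReal = (T : ℝ) + 1 := by
      rw [ENNReal.toReal_add (by finiteness) (by finiteness)]
      simp
    rw [this]
  have heff : ∀ i : Fin T, (law M S F T).real
      {h | 1 / (T : ℝ) < |((h i).2.1 : ℝ) - bestEffort hbr (h i).1|} ≤ 4 / (T : ℝ) ^ 3 := by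
    intro i
    have hi : Measurable fun h : History E T => (h i).1 := (measurable_pi_apply i).fst
    have hb : Measurable fun h : History E T => ((bestEffort hbr (h i).1 : Effort E) : ℝ) :=
      measurable_subtype_coe.comp ((measurable_bestEffort hbr).comp hi)
    have h' : Measurable fun h : History E T => ((h i).2.1 : ℝ) := by fun_prop
    have hint : Integrable (fun h : History E T =>
        (((h i).2.1 : ℝ) - bestEffort hbr (h i).1) ^ 2) (law M S F T) := by
      refine Integrable.of_bound ((h'.sub hb).pow_const 2).aestronglyMeasurable 1
        (Eventually.of_forall fun h => ?_)
      rw [Real.norm_eq_abs, abs_of_nonneg (sq_nonneg _)]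
      have e1 := (h i).2.1.2
      have e2 := (bestEffort hbr (h i).1).2
      rw [sq_le_one_iff_abs_le_one, abs_le]
      constructor <;> linarith [e1.1, e1.2, e2.1, e2.2]
    have h1 := mul_meas_ge_le_integral_of_nonneg (Eventually.of_forall fun h => sq_nonneg _) hint
      ((1 / (T : ℝ)) ^ 2)
    have h2 : (law M S F T).real
        {h | 1 / (T : ℝ) < |((h i).2.1 : ℝ) - bestEffort hbr (h i).1|} ≤ (law M S F T).real
        {h | (1 / (T : ℝ)) ^ 2 ≤ (((h i).2.1 : ℝ) - bestEffort hbr (h i).1) ^ 2} := by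
      refine measureReal_mono fun h hh => ?_
      simp only [Set.mem_ofPred_eq] at hh ⊢
      rw [← sq_abs (((h i).2.1 : ℝ) - bestEffort hbr (h i).1)]
      gcongr
    have h3 := h1.trans (hsq i)
    refine h2.trans ?_
    have h4 : (1 / (T : ℝ)) ^ 2 * (4 / (T : ℝ) ^ 3) = 4 / (T : ℝ) ^ 5 := by field_simp
    rw [← h4] at h3
    exact le_of_mul_le_mul_left h3 (by positivity)
  have hunion : (law M S F T).real (deviationEvent E C T ∪
      ⋃ i : Fin T, {h | 1 / (T : ℝ) < |((h i).2.1 : ℝ) - bestEffort hbr (h i).1|}) ≤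
      ((T + 1) * (K * ((T + 1) * 2))) * ((T : ℝ) ^ 4)⁻¹ + T * (4 / (T : ℝ) ^ 3) := by
    refine (measureReal_union_le _ _).trans (add_le_add hdev ?_)
    refine (measureReal_iUnion_fintype_le _).trans ?_
    refine (Finset.sum_le_sum fun i _ => heff i).trans (le_of_eq ?_)
    simp
  have hKle : (K : ℝ) ≤ 2 * T := by
    have : (0 : ℝ) ≤ K := by positivity
    nlinarith
  calc (T : ℝ) * _ ≤ T * (((T + 1) * (K * ((T + 1) * 2))) * ((T : ℝ) ^ 4)⁻¹ +
        T * (4 / (T : ℝ) ^ 3)) := by gcongr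
    _ ≤ T * (((T + T / 3) * (2 * T * ((T + T / 3) * 2))) * ((T : ℝ) ^ 4)⁻¹ +
        T * (4 / (T : ℝ) ^ 3)) := by gcongr <;> linarith
    _ = 64 / 9 + 4 / T := by field_simp; ring
    _ ≤ 20 := by
      have : 4 / (T : ℝ) ≤ 4 := div_le_self (by norm_num) (by linarith)
      linarith

/-- Regret of delayed elimination on the grid. -/
theorem strategicRegret_le (hT : 3 ≤ T) (hK : 0 < K) (hKT : (K : ℝ) ^ 2 ≤ 4 * T)
    {βs c₀ C₀ : ℝ} (hβs : βs ∈ Set.Icc (0 : ℝ) 1) (hc₀ : 0 < c₀) (hC₀ : 32 ≤ C₀)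
    (hgap : ∀ β ∈ Set.Icc (0 : ℝ) 1,
      c₀ * (β - βs) ^ 2 ≤ truthfulUtility a βs - truthfulUtility a β ∧
      truthfulUtility a βs - truthfulUtility a β ≤ C₀ * (β - βs) ^ 2)
    (hc : MonotoneOn c (Set.Icc (0 : ℝ) E)) (hc0 : c 0 = 0) (hE : 0 ≤ E)
    (hbr : IsBestResponse E c a) {lam : ℝ} (hlam : 0 < lam)
    (hsc : StrongConvexOn (Set.Icc (0 : ℝ) E) lam c) {γ : ℝ} (hγ0 : 0 < γ) (hγ1 : γ < 1)
    (hD : γ ^ D ≤ lam / (T : ℝ) ^ 6) (F : Technology E) (S : Strategy E)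
    (hS : IsOptimalStrategy c γ T F (delayedElimination (grid K) T D (1 / T)) S) :
    strategicRegret a T F (delayedElimination (grid K) T D (1 / T)) S ≤
      T * (2 * C₀ / K ^ 2) + 8196 / c₀ * (Real.log T * K ^ 2) +
        2 * ((D + 1 + 2 * K : ℕ) : ℝ) + 23 := by
  have hE1 := effort_le_one F hE
  have hT3 : (3 : ℝ) ≤ T := by exact_mod_cast hT
  have hT0 : (0 : ℝ) < T := by positivity
  set M := delayedElimination (grid K) T D (1 / (T : ℝ)) with hM
  set μ := law M S F T with hμ
  set path := T * (2 * C₀ / K ^ 2) + 8196 / c₀ * (Real.log T * K ^ 2) +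
        2 * ((D + 1 + 2 * K : ℕ) : ℝ) with hpath
  have hlog := one_le_log hT
  have hpath0 : 0 ≤ path := by positivity
  have hsq : ∀ i : Fin T, ∫ h, (((h i).2.1 : ℝ) - bestEffort hbr (h i).1) ^ 2 ∂μ ≤
      4 / (T : ℝ) ^ 5 := by
    intro i
    refine (expected_sq_deviation_le S F (grid K) D (1 / T) hc hc0 hE hE1 hbr hlam hsc hγ0 hγ1
      hS i).trans ?_
    calc 4 / lam * (T * γ ^ D) ≤ 4 / lam * (T * (lam / (T : ℝ) ^ 6)) := by gcongr
      _ = 4 / (T : ℝ) ^ 5 := by field_simp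
  have hone : ∀ β ∈ Set.Icc (0 : ℝ) 1, truthfulUtility a βs - truthfulUtility a β ≤ 1 :=
    fun β hβ => by
      have e1 := truthfulUtility_le hbr hβs
      have e2 := truthfulUtility_nonneg hbr hβ
      linarith
  have hnonneg : ∀ β ∈ Set.Icc (0 : ℝ) 1, 0 ≤ truthfulUtility a βs - truthfulUtility a β :=
    fun β hβ => le_trans (by positivity) (hgap β hβ).1
  set bad := deviationEvent E (grid K) T ∪
      ⋃ i : Fin T, {h | 1 / (T : ℝ) < |((h i).2.1 : ℝ) - bestEffort hbr (h i).1|} with hbad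
  have hbadT := measure_bad_le hT hKT M S F hE1 hbr (grid K) hsq
  -- The measurable hull has the same measure as `bad`, so measurability of `bad` itself need not be
  -- checked.
  have hgapsum : ∀ᵐ h ∂μ, ∑ i, (truthfulUtility a βs - truthfulUtility a (h i).1) ≤
      path + (toMeasurable μ bad).indicator (fun _ => (T : ℝ)) h := by
    filter_upwards [ae_posted (grid K) T D (1 / T) S F T] with h hh
    by_cases hb : h ∈ toMeasurable μ bad
    · rw [Set.indicator_of_mem hb]
      have : ∑ i, (truthfulUtility a βs - truthfulUtility a (h i).1) ≤ ∑ _i : Fin T, (1 : ℝ) :=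
        Finset.sum_le_sum fun i _ => hone _ (h i).1.2
      simp only [Finset.sum_const, Finset.card_univ, Fintype.card_fin, nsmul_eq_mul,
        mul_one] at this
      linarith
    · rw [Set.indicator_of_notMem hb, add_zero]
      have hb' : h ∉ bad := fun h' => hb (subset_toMeasurable μ bad h')
      simp only [hbad, Set.mem_union, Set.mem_iUnion, Set.mem_ofPred_eq, not_or, not_exists,
        not_lt] at hb'
      exact sum_gap_grid_le (h := publicPart h) hT hK hKT hβs hc₀ hC₀ hgap hone
        (accurate_of_notMem hT hb'.1 hb'.2) hh
  have hi : ∀ i : Fin T, Measurable fun h : History E T => (h i).1 :=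
    fun i => (measurable_pi_apply i).fst
  have hb : ∀ i : Fin T, Measurable fun h : History E T =>
      ((bestEffort hbr (h i).1 : Effort E) : ℝ) := fun i =>
    measurable_subtype_coe.comp ((measurable_bestEffort hbr).comp (hi i))
  have hu : ∀ i : Fin T, Measurable fun h : History E T =>
      truthfulUtility a βs - truthfulUtility a (h i).1 := fun i => by
    have e1 : Measurable fun h : History E T => ((h i).1 : ℝ) := by fun_prop
    exact measurable_const.sub ((measurable_const.sub e1).mul (hb i))
  have hgint : ∀ i : Fin T, Integrable (fun h : History E T =>
      truthfulUtility a βs - truthfulUtility a (h i).1) μ := fun i =>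
    Integrable.of_bound (hu i).aestronglyMeasurable 1 (Eventually.of_forall fun h => by
      rw [Real.norm_eq_abs, abs_of_nonneg (hnonneg _ (h i).1.2)]
      exact hone _ (h i).1.2)
  have hexp : ∑ i : Fin T, ∫ h, (truthfulUtility a βs - truthfulUtility a (h i).1) ∂μ ≤
      path + 20 := by
    rw [← integral_finsetSum _ fun i _ => hgint i]
    have hind : Integrable ((toMeasurable μ bad).indicator fun _ => (T : ℝ)) μ :=
      (integrable_const _).indicator (measurableSet_toMeasurable _ _)
    refine (integral_mono_ae (integrable_finsetSum _ fun i _ => hgint i)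
      ((integrable_const path).add hind) hgapsum).trans ?_
    rw [integral_add' (integrable_const path) hind,
      integral_indicator (measurableSet_toMeasurable _ _)]
    simp only [integral_const, measureReal_restrict_apply_univ, smul_eq_mul, probReal_univ,
      one_mul]
    have : μ.real (toMeasurable μ bad) = μ.real bad := by
      simp only [measureReal_def, measure_toMeasurable]
    rw [this, mul_comm]
    linarith
  have hdev : ∀ i : Fin T,
      ∫ h, (truthfulUtility a βs - (1 - ((h i).1 : ℝ)) * ((h i).2.1 : ℝ)) ∂μ ≤
      ∫ h, (truthfulUtility a βs - truthfulUtility a (h i).1) ∂μ + 3 / T := by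
    intro i
    have h' : Measurable fun h : History E T => ((h i).2.1 : ℝ) := by fun_prop
    have e1 : Measurable fun h : History E T => ((h i).1 : ℝ) := by fun_prop
    have hint : Integrable (fun h : History E T =>
        (((h i).2.1 : ℝ) - bestEffort hbr (h i).1) ^ 2) μ := by
      refine Integrable.of_bound ((h'.sub (hb i)).pow_const 2).aestronglyMeasurable 1
        (Eventually.of_forall fun h => ?_)
      rw [Real.norm_eq_abs, abs_of_nonneg (sq_nonneg _)]
      have e1 := (h i).2.1.2
      have e2 := (bestEffort hbr (h i).1).2
      rw [sq_le_one_iff_abs_le_one, abs_le]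
      constructor <;> linarith [e1.1, e1.2, e2.1, e2.2]
    have hadd : Integrable (fun h : History E T =>
        1 / (T : ℝ) + T * (((h i).2.1 : ℝ) - bestEffort hbr (h i).1) ^ 2) μ :=
      (integrable_const _).add (hint.const_mul _)
    have hleft : Integrable (fun h : History E T =>
        truthfulUtility a βs - (1 - ((h i).1 : ℝ)) * ((h i).2.1 : ℝ)) μ := by
      refine (integrable_const _).sub (Integrable.of_bound
        ((measurable_const.sub e1).mul h').aestronglyMeasurable 1
        (Eventually.of_forall fun h => ?_))
      have e1 := (h i).1.2
      have e2 := (h i).2.1.2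
      rw [Real.norm_eq_abs, abs_of_nonneg (mul_nonneg (by linarith [e1.2]) e2.1)]
      exact mul_le_one₀ (by linarith [e1.1]) e2.1 (e2.2.trans hE1)
    calc _ ≤ ∫ h, ((truthfulUtility a βs - truthfulUtility a (h i).1) +
          (1 / (T : ℝ) + T * (((h i).2.1 : ℝ) - bestEffort hbr (h i).1) ^ 2)) ∂μ := by
          refine integral_mono hleft ((hgint i).add hadd) fun h => ?_
          simp only [truthfulUtility]
          have e1 := (h i).1.2
          set y : ℝ := ((h i).2.1 : ℝ) - bestEffort hbr (h i).1 with hy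
          have hy' : a (h i).1 = ((h i).2.1 : ℝ) - y := by
            rw [hy]
            simp [bestEffort]
          rw [hy']
          -- This trades the first moment of the effort error for the second moment, which is
          -- already controlled.
          have h1 : |y| ≤ 1 / (T : ℝ) + T * y ^ 2 := by
            rw [← sq_abs y]
            have e3 : (T : ℝ) * (1 / T) = 1 := by field_simp
            have e4 := abs_nonneg y
            rcases le_total |y| (1 / T) with h | h
            · have : 0 ≤ (T : ℝ) * |y| ^ 2 := by positivity
              linarith
            · have : (T : ℝ) * (1 / T) * |y| ≤ T * |y| * |y| := by gcongr
              rw [e3] at this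
              have : (0 : ℝ) < 1 / T := by positivity
              nlinarith
          have h2 : -((1 - ((h i).1 : ℝ)) * y) ≤ |y| := by
            refine (neg_le_abs _).trans ?_
            rw [abs_mul, abs_of_nonneg (by linarith [e1.2])]
            exact mul_le_of_le_one_left (abs_nonneg _) (by linarith [e1.1])
          linarith
      _ = ∫ h, (truthfulUtility a βs - truthfulUtility a (h i).1) ∂μ +
          (1 / T + T * ∫ h, (((h i).2.1 : ℝ) - bestEffort hbr (h i).1) ^ 2 ∂μ) := by
          rw [integral_add (hgint i) hadd,
            integral_add (integrable_const _) (hint.const_mul _), integral_const_mul]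
          simp
      _ ≤ _ := by
          gcongr
          have e1 : (T : ℝ) * ∫ h, (((h i).2.1 : ℝ) - bestEffort hbr (h i).1) ^ 2 ∂μ ≤
              T * (4 / (T : ℝ) ^ 5) := by
            gcongr
            exact hsq i
          have e2 : (T : ℝ) * (4 / (T : ℝ) ^ 5) = 4 / T ^ 3 * (1 / T) := by field_simp
          have e3 : 4 / (T : ℝ) ^ 3 ≤ 1 := by
            rw [div_le_one (by positivity)]
            have : (3 : ℝ) ^ 3 ≤ (T : ℝ) ^ 3 := by gcongr
            linarith
          have e4 : 4 / (T : ℝ) ^ 3 * (1 / T) ≤ 1 * (1 / T) := by gcongr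
          have e5 : 3 / (T : ℝ) = 3 * (1 / T) := by ring
          have e6 : (0 : ℝ) < 1 / T := by positivity
          linarith
  have hsup : (⨆ β : Set.Icc (0 : ℝ) 1, (T : ℝ) * truthfulUtility a β) ≤
      T * truthfulUtility a βs := by
    have : Nonempty (Set.Icc (0 : ℝ) 1) := ⟨⟨βs, hβs⟩⟩
    refine ciSup_le fun β => ?_
    gcongr
    exact sub_nonneg.1 (hnonneg β β.2)
  have hval : T * truthfulUtility a βs - principalValue T F M S =
      ∑ i : Fin T, ∫ h, (truthfulUtility a βs - (1 - ((h i).1 : ℝ)) * ((h i).2.1 : ℝ)) ∂μ := by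
    rw [principalValue_eq_sum M S F]
    have : (T : ℝ) * truthfulUtility a βs = ∑ _i : Fin T, truthfulUtility a βs := by simp
    rw [this, ← Finset.sum_sub_distrib]
    refine Finset.sum_congr rfl fun i _ => ?_
    rw [integral_sub (integrable_const _)]
    · simp [hμ]
    · refine Integrable.of_bound (by fun_prop) 1 (Eventually.of_forall fun h => ?_)
      have e1 := (h i).1.2
      have e2 := (h i).2.1.2
      rw [Real.norm_eq_abs, abs_of_nonneg (mul_nonneg (by linarith [e1.2]) e2.1)]
      exact mul_le_one₀ (by linarith [e1.1]) e2.1 (e2.2.trans hE1)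
  unfold strategicRegret
  have h1 := Finset.sum_le_sum fun i (_ : i ∈ Finset.univ) => hdev i
  rw [Finset.sum_add_distrib, ← hval] at h1
  have h2 : ∑ _i : Fin T, 3 / (T : ℝ) = 3 := by
    simp only [Finset.sum_const, Finset.card_univ, Fintype.card_fin, nsmul_eq_mul]
    field_simp
  rw [h2] at h1
  linarith

end Regret

/-! ### Choice of the parameters and the final bound -/

section Parameters

/-- Number of bins. -/
noncomputable def bins (T : ℕ) : ℕ := max 1 ⌈Real.sqrt (Real.sqrt (T / Real.log T))⌉₊

/-- Delay. -/
noncomputable def delay (T : ℕ) (γ lam : ℝ) : ℕ :=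
  ⌈Real.log ((T : ℝ) ^ 6 / lam) / Real.log (1 / γ)⌉₊

theorem pow_delay_le {T : ℕ} (hT : 0 < T) {γ lam : ℝ} (hγ0 : 0 < γ) (hγ1 : γ < 1)
    (hlam : 0 < lam) : γ ^ delay T γ lam ≤ lam / (T : ℝ) ^ 6 := by
  have hT' : (0 : ℝ) < T := by exact_mod_cast hT
  have hL : 0 < Real.log (1 / γ) := Real.log_pos (by rw [lt_div_iff₀ hγ0]; linarith)
  have h1 : Real.log ((T : ℝ) ^ 6 / lam) / Real.log (1 / γ) ≤ delay T γ lam := Nat.le_ceil _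
  rw [div_le_iff₀ hL] at h1
  rw [← Real.log_le_log_iff (by positivity) (by positivity), Real.log_pow]
  have h2 : Real.log (1 / γ) = -Real.log γ := by rw [one_div, Real.log_inv]
  have h3 : Real.log (lam / (T : ℝ) ^ 6) = -Real.log ((T : ℝ) ^ 6 / lam) := by
    rw [← Real.log_inv, inv_div]
  rw [h2] at h1
  rw [h3]
  linarith

theorem log_le_two_mul_sqrt {x : ℝ} (hx : 0 < x) : Real.log x ≤ 2 * Real.sqrt x := by
  have h1 := Real.log_le_sub_one_of_pos (Real.sqrt_pos.2 hx)
  rw [Real.log_sqrt hx.le] at h1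
  linarith

theorem bins_sq_bounds {T : ℕ} (hT : 3 ≤ T) :
    Real.sqrt (T / Real.log T) ≤ (bins T : ℝ) ^ 2 ∧
      (bins T : ℝ) ^ 2 ≤ 4 * Real.sqrt (T / Real.log T) := by
  have hlog := one_le_log hT
  have hT0 : (0 : ℝ) < T := by positivity
  have hs1 : 1 ≤ (T : ℝ) / Real.log T := by
    rw [le_div_iff₀ (by linarith), one_mul]
    linarith [Real.log_le_sub_one_of_pos hT0]
  set s := Real.sqrt (T / Real.log T) with hs
  have hs1' : 1 ≤ s := Real.one_le_sqrt.2 hs1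
  set r := Real.sqrt s with hr
  have hr1 : 1 ≤ r := Real.one_le_sqrt.2 hs1'
  have hr2 : r ^ 2 = s := Real.sq_sqrt (by linarith)
  have hbins : bins T = ⌈r⌉₊ := max_eq_right (Nat.one_le_ceil_iff.2 (by linarith))
  have h1 : r ≤ bins T := by rw [hbins]; exact Nat.le_ceil r
  have h2 : (bins T : ℝ) ≤ 2 * r := by
    rw [hbins]
    linarith [Nat.ceil_lt_add_one (show 0 ≤ r by linarith)]
  constructor
  · rw [← hr2]; gcongr
  · calc (bins T : ℝ) ^ 2 ≤ (2 * r) ^ 2 := by gcongr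
      _ = 4 * s := by rw [mul_pow, hr2]; norm_num

theorem le_discountSum {T : ℕ} (hT : 0 < T) {γ : ℝ} (hγ0 : 0 < γ) : γ ≤ discountSum γ T := by
  unfold discountSum
  have := Finset.single_le_sum (f := fun t => γ ^ t) (s := Finset.Icc 1 T)
    (fun t _ => by positivity) (Finset.mem_Icc.2 ⟨le_rfl, hT⟩)
  simpa using this

/-- From `discountSum γ T ≥ γ`, replacing `T * discountSum γ T / lam` by `T / lam` costs at most
`log (1 / γ)`, hence the `+ 1` after division; the quotient alone may be negative. As `log lam ≤ log
T / 2`, the sixth power of `T` costs only the factor `12`. -/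
theorem delay_le {T : ℕ} (hT : 3 ≤ T) {γ lam : ℝ} (hγ0 : 0 < γ) (hγ1 : γ < 1)
    (hlam : 0 < lam) (hlamT : lam ^ 2 ≤ T) :
    0 ≤ Real.log (T * discountSum γ T / lam) / Real.log (1 / γ) + 1 ∧
    (delay T γ lam : ℝ) ≤
      12 * (Real.log (T * discountSum γ T / lam) / Real.log (1 / γ) + 1) + 1 := by
  have hT0 : (0 : ℝ) < T := by positivity
  have hlog := one_le_log hT
  have hL : 0 < Real.log (1 / γ) := Real.log_pos (by rw [lt_div_iff₀ hγ0]; linarith)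
  have h2 : Real.log (1 / γ) = -Real.log γ := by rw [one_div, Real.log_inv]
  have hll : 2 * Real.log lam ≤ Real.log T := by
    have := Real.log_le_log (by positivity) hlamT
    rwa [Real.log_pow, Nat.cast_ofNat] at this
  have e1 : Real.log ((T : ℝ) ^ 6 / lam) = 6 * Real.log T - Real.log lam := by
    rw [Real.log_div (by positivity) hlam.ne', Real.log_pow]
    norm_num
  have hdisc := le_discountSum (T := T) (by omega) hγ0
  have e2 : Real.log T - Real.log lam ≤
      Real.log (T * discountSum γ T / lam) + Real.log (1 / γ) := by
    have h3 : Real.log (T * γ / lam) ≤ Real.log (T * discountSum γ T / lam) :=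
      Real.log_le_log (by positivity) (by gcongr)
    rw [Real.log_div (by positivity) hlam.ne', Real.log_mul (by positivity) hγ0.ne'] at h3
    linarith
  have e3 : (Real.log T - Real.log lam) / Real.log (1 / γ) ≤
      Real.log (T * discountSum γ T / lam) / Real.log (1 / γ) + 1 := by
    rw [div_add_one hL.ne']
    gcongr
  have e4 : 0 ≤ (Real.log T - Real.log lam) / Real.log (1 / γ) :=
    div_nonneg (by linarith) hL.le
  refine ⟨e4.trans e3, ?_⟩
  have e5 : Real.log ((T : ℝ) ^ 6 / lam) / Real.log (1 / γ) ≤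
      12 * ((Real.log T - Real.log lam) / Real.log (1 / γ)) := by
    rw [e1, ← mul_div_assoc]
    gcongr
    linarith
  have e6 : 0 ≤ Real.log ((T : ℝ) ^ 6 / lam) / Real.log (1 / γ) := by
    rw [e1]
    exact div_nonneg (by linarith) hL.le
  have := (Nat.ceil_lt_add_one e6).le
  change (delay T γ lam : ℝ) ≤ _ at this
  linarith

/-- Strong convexity at the midpoint of `0` and `E`, with `c (E / 2) ≥ 0`. It bounds all admissible
moduli by `E` and `c`, so the threshold on `T` can be uniform in `lam`. -/
theorem strongConvexOn_modulus_le {E lam : ℝ} {c : ℝ → ℝ} (hE : 0 < E)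
    (hc : MonotoneOn c (Set.Icc (0 : ℝ) E)) (hc0 : c 0 = 0)
    (hsc : StrongConvexOn (Set.Icc (0 : ℝ) E) lam c) : lam ≤ 4 * c E / E ^ 2 := by
  have h0 : (0 : ℝ) ∈ Set.Icc (0 : ℝ) E := ⟨le_rfl, hE.le⟩
  have h1 : E ∈ Set.Icc (0 : ℝ) E := ⟨hE.le, le_rfl⟩
  have hsc' := (show UniformConvexOn _ _ _ from hsc).2
  have h2 := hsc' h0 h1 (a := 1 / 2) (b := 1 / 2) (by norm_num) (by norm_num) (by norm_num)
  simp only [smul_eq_mul, Real.norm_eq_abs, sq_abs, hc0] at h2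
  have h3 := hc h0 (show 1 / 2 * 0 + 1 / 2 * E ∈ Set.Icc (0 : ℝ) E from
    ⟨by linarith, by linarith⟩) (by linarith)
  rw [hc0] at h3
  rw [le_div_iff₀ (by positivity)]
  linarith

/-- The regret of delayed elimination in the form of the final bound. -/
theorem regret_bound_le {T : ℕ} (hT : 64 ≤ T) {γ lam : ℝ} (hγ0 : 0 < γ) (hγ1 : γ < 1)
    (hlam : 0 < lam) (hlamT : lam ^ 2 ≤ T) {A C : ℝ} (hA : 0 ≤ A) (hC : 0 ≤ C) :
    T * (2 * C / (bins T : ℝ) ^ 2) + A * (Real.log T * (bins T : ℝ) ^ 2) +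
        2 * ((delay T γ lam + 1 + 2 * bins T : ℕ) : ℝ) + 23 ≤
      2 * (2 * C + 4 * A + 43) * (Real.sqrt (T * Real.log T) +
        Real.log (T * discountSum γ T / lam) * Real.log (T / Real.log T) /
          Real.log (1 / γ)) := by
  have hT64 : (64 : ℝ) ≤ T := by exact_mod_cast hT
  have hT0 : (0 : ℝ) < T := by linarith
  have hlog := one_le_log (show 3 ≤ T by omega)
  obtain ⟨hL1, hdel⟩ := delay_le (show 3 ≤ T by omega) hγ0 hγ1 hlam hlamT
  obtain ⟨hb1, hb2⟩ := bins_sq_bounds (show 3 ≤ T by omega)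
  set ℓ := Real.log T with hℓ
  set R := Real.sqrt (T * ℓ) with hR
  set s := Real.sqrt (T / ℓ) with hs
  set L := Real.log (T * discountSum γ T / lam) / Real.log (1 / γ) with hL
  set m := Real.log (T / ℓ) with hm
  have hs0 : 0 < s := Real.sqrt_pos.2 (by positivity)
  have hsl : s * ℓ = R := by
    rw [hs, hR, ← Real.sqrt_sq (show 0 ≤ ℓ by linarith), ← Real.sqrt_mul (by positivity),
      Real.sqrt_sq (show 0 ≤ ℓ by linarith)]
    congr 1
    field_simp
  have hsR : s * R = T := by
    rw [hs, hR, ← Real.sqrt_mul (by positivity)]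
    rw [show (T : ℝ) / ℓ * (T * ℓ) = T ^ 2 by field_simp]
    exact Real.sqrt_sq hT0.le
  have hsq : 8 ≤ Real.sqrt T := Real.le_sqrt_of_sq_le (by linarith)
  have hsqT : Real.sqrt T * Real.sqrt T = T := Real.mul_self_sqrt hT0.le
  have hl2 : ℓ ≤ 2 * Real.sqrt T := log_le_two_mul_sqrt hT0
  have hm1 : 1 ≤ m := by
    rw [hm, Real.le_log_iff_exp_le (by positivity), le_div_iff₀ (by linarith)]
    have := Real.exp_one_lt_d9
    nlinarith
  have hmR : 2 * m ≤ R := by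
    have h1 : m ≤ ℓ := Real.log_le_log (by positivity) (div_le_self hT0.le hlog)
    have h2 : 2 * ℓ ≤ R := by
      have h4 : 4 * ℓ ≤ T := by nlinarith
      refine Real.le_sqrt_of_sq_le ?_
      have := mul_le_mul_of_nonneg_right h4 (show 0 ≤ ℓ by linarith)
      linarith
    linarith
  have hR1 : 1 ≤ R := by linarith
  have hsR' : s ≤ R := by rw [← hsl]; exact le_mul_of_one_le_right hs0.le hlog
  have hb0 : (1 : ℝ) ≤ bins T := by exact_mod_cast le_max_left _ _
  have hb3 : (bins T : ℝ) ≤ 4 * R := by nlinarith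
  have t1 : T * (2 * C / (bins T : ℝ) ^ 2) ≤ 2 * C * R := by
    calc T * (2 * C / (bins T : ℝ) ^ 2) ≤ T * (2 * C / s) := by gcongr
      _ = 2 * C * R := by rw [← hsR]; field_simp
  have t2 : A * (ℓ * (bins T : ℝ) ^ 2) ≤ 4 * A * R := by
    calc A * (ℓ * (bins T : ℝ) ^ 2) ≤ A * (ℓ * (4 * s)) := by gcongr
      _ = 4 * A * R := by rw [← hsl]; ring
  have t3 : L + 1 ≤ (L + 1) * m := le_mul_of_one_le_right hL1 hm1
  have hform : Real.log (T * discountSum γ T / lam) * m / Real.log (1 / γ) = L * m := by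
    rw [hL]; ring
  rw [hform]
  -- The extra `m` coming from `L + 1` is absorbed in half of `R`, by `2 * m ≤ R`; this is why the
  -- constant is doubled.
  have t4 : R / 2 + (L + 1) * m ≤ R + L * m := by linarith
  have hB : 0 ≤ 2 * (2 * C + 4 * A + 43) := by positivity
  refine le_trans ?_ (mul_le_mul_of_nonneg_left t4 hB)
  push_cast
  have t5 : 24 * ((L + 1) * m) ≤ 2 * (2 * C + 4 * A + 43) * ((L + 1) * m) := by
    have : 0 ≤ (L + 1) * m := hL1.trans t3
    gcongr
    linarith
  linarith

end Parameters

end RepeatedContract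

/-! ### The theorem -/

theorem mainTheorem6 :
    -- the number of bins, the delay and the perturbation are chosen from `T`, `γ`, `lam` only
    ∃ (K D : ℕ → ℝ → ℝ → ℕ) (δ : ℕ → ℝ → ℝ → ℝ),
      (∀ T γ lam, 0 < K T γ lam ∧ 0 ≤ δ T γ lam) ∧
      ∀ (E : ℝ) (c a : ℝ → ℝ),
        0 < E →
        MonotoneOn c (Set.Icc (0 : ℝ) E) →
        c 0 = 0 →
        RepeatedContract.IsBestResponse E c a →
        -- unique optimal contract, at which the second derivative of the utility is nonzero
        (∃ βs ∈ Set.Icc (0 : ℝ) 1,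
          (∀ β ∈ Set.Icc (0 : ℝ) 1, β ≠ βs →
            RepeatedContract.truthfulUtility a β < RepeatedContract.truthfulUtility a βs) ∧
          (∀ᶠ β in 𝓝 βs, DifferentiableAt ℝ (RepeatedContract.truthfulUtility a) β) ∧
          ∃ d : ℝ, d ≠ 0 ∧ HasDerivAt (deriv (RepeatedContract.truthfulUtility a)) d βs) →
        ∃ (B : ℝ) (T₀ : ℕ),
          ∀ lam : ℝ, 0 < lam → StrongConvexOn (Set.Icc (0 : ℝ) E) lam c →
          ∀ γ : ℝ, 0 < γ → γ < 1 →
          ∀ T : ℕ, T₀ ≤ T →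
          ∀ (F : RepeatedContract.Technology E) (S : RepeatedContract.Strategy E),
            RepeatedContract.IsOptimalStrategy c γ T F
              (RepeatedContract.delayedElimination (RepeatedContract.grid (K T γ lam)) T
                (D T γ lam) (δ T γ lam)) S →
            RepeatedContract.strategicRegret a T F
              (RepeatedContract.delayedElimination (RepeatedContract.grid (K T γ lam)) T
                (D T γ lam) (δ T γ lam)) S ≤
              B * (Real.sqrt ((T : ℝ) * Real.log (T : ℝ)) +
                Real.log ((T : ℝ) * RepeatedContract.discountSum γ T / lam) *
                  Real.log ((T : ℝ) / Real.log (T : ℝ)) / Real.log (1 / γ)) := by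
  refine ⟨fun T _ _ => RepeatedContract.bins T, RepeatedContract.delay, fun T _ _ => 1 / T,
    fun T γ lam => ⟨Nat.lt_of_lt_of_le one_pos (le_max_left _ _), by positivity⟩, ?_⟩
  rintro E c a hE hc hc0 hbr ⟨βs, hβs, hmax, hdiff, d, hd0, hd⟩
  -- The constants must not depend on `lam`: one fixed modulus yields the quadratic gap, and without
  -- any modulus the claim is vacuous.
  by_cases hex : ∃ lam : ℝ, 0 < lam ∧ StrongConvexOn (Set.Icc (0 : ℝ) E) lam c
  swap
  · exact ⟨0, 0, fun lam h1 h2 => absurd ⟨lam, h1, h2⟩ hex⟩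
  obtain ⟨lam₀, hlam₀, hsc₀⟩ := hex
  obtain ⟨c₀, hc₀, C₀, hC₀, hgap⟩ :=
    RepeatedContract.exists_quadratic_gap hE.le hc hlam₀ hbr hsc₀ hβs hmax hdiff hd0 hd
  -- The second entry of the threshold ensures `lam ^ 2 ≤ T` for every admissible `lam`.
  refine ⟨2 * (2 * max C₀ 32 + 4 * (8196 / c₀) + 43), max 64 ⌈(4 * c E / E ^ 2) ^ 2⌉₊, ?_⟩
  intro lam hlam hsc γ hγ0 hγ1 T hT F S hS
  have hT64 : 64 ≤ T := (le_max_left _ _).trans hT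
  have hlamT : lam ^ 2 ≤ T := by
    have h1 := RepeatedContract.strongConvexOn_modulus_le hE hc hc0 hsc
    have h2 : (4 * c E / E ^ 2) ^ 2 ≤ T := Nat.ceil_le.1 ((le_max_right _ _).trans hT)
    exact le_trans (by gcongr) h2
  have hT0 : (0 : ℝ) < T := by positivity
  have hlog := RepeatedContract.one_le_log (show 3 ≤ T by omega)
  have hKT : (RepeatedContract.bins T : ℝ) ^ 2 ≤ 4 * T := by
    refine (RepeatedContract.bins_sq_bounds (show 3 ≤ T by omega)).2.trans ?_
    gcongr
    have h1 : (T : ℝ) / Real.log T ≤ T := div_le_self hT0.le hlog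
    have hT1 : (1 : ℝ) ≤ T := by exact_mod_cast (by omega : 1 ≤ T)
    rw [Real.sqrt_le_left hT0.le]
    nlinarith
  refine (RepeatedContract.strategicRegret_le (show 3 ≤ T by omega)
    (Nat.lt_of_lt_of_le one_pos (le_max_left _ _)) hKT hβs hc₀ (le_max_right C₀ 32)
    (fun β hβ => ⟨(hgap β hβ).1, (hgap β hβ).2.trans (by gcongr; exact le_max_left _ _)⟩)
    hc hc0 hE.le hbr hlam hsc hγ0 hγ1
    (RepeatedContract.pow_delay_le (by omega) hγ0 hγ1 hlam) F S hS).trans ?_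
  exact RepeatedContract.regret_bound_le hT64 hγ0 hγ1 hlam hlamT (by positivity) (by positivity)
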